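/- Let $I$ (agents) and $O$ (objects) be finite sets, $O\neq\emptyset$. Let $q_l>0$ ($l\in O$) be the capacities and $c^i>0$ ($i\in I$) the maximum overall demands, with $\sum_{l}q_l\le\sum_i c^i$. Agent $i$ has consumption space $C^i=\{x\in\mathbb R_+^O:\sum_l x_l\le c^i\}$, reservation utility $\tilde u^i\in\mathbb R$, and a utility function $u^i$ that is real-valued and continuous on $C^i$ and equals $-\infty$ outside $C^i$. Assume that $u^i(x)<u^i(y)$ whenever $x,y\in C^i$ and $x_l<y_l$ for all $l$. Call $u^i$ strongly monotone if $u^i(x)<u^i(y)$ whenever $x,y\in C^i$, $x\le y$ and $x\ne y$. Concavity, quasi-concavity and linearity of $u^i$ refer to $C^i$ (linear: $u^i(x)=v\cdot x$ on $C^i$ for some vector $v$). An allocation is $x=(x^i)_{i\in I}$ with $x^i\in C^i$ for all $i$ and $\sum_i x^i_l=q_l$ for all $l$. It is individually rational (IR) if $u^i(x^i)\ge\tilde u^i$ for all $i$, and $\varepsilon$-IR if $u^i(x^i)\ge\tilde u^i-\varepsilon$ for all $i$. It is Pareto optimal if there is no allocation $y$ with $u^i(y^i)\ge u^i(x^i)$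 for all $i$, one inequality being strict; weakly Pareto optimal if there is none with $u^i(y^i)>u^i(x^i)$ for all $i$; $\varepsilon$-Pareto optimal if there is none with $u^i(y^i)>u^i(x^i)+\varepsilon$ for all $i$. Assume that an IR allocation exists. Agent $i$ envies $j$ at $x$ if $u^i(x^j)>u^i(x^i)$. Agent $i$ has justified envy by exchange towards $j$ at $x$ if there are distinct agents $i_1=i,\ i_2=j,\dots,i_K$ ($K\ge2$) such that $i_k$ envies $i_{k+1}$ for $1\le k\le K-1$ and $u^{i_K}(x^{i_1})\ge\tilde u^{i_K}$. The envy is called strong if the last condition is replaced by $u^{i_K}(x^{i_1})>\tilde u^{i_K}$, and $\varepsilon$-justified envy by exchange is obtained by replacing it with $u^{i_K}(x^{i_1})>\tilde u^{i_K}-\varepsilon$. (A) Suppose that every $u^i$ is concave. 1. For every $\varepsilon>0$ there is an allocation that is $\varepsilon$-IR, $\varepsilon$-Pareto optimal and has no $\varepsilon$-justified envy by exchange. 2. There is an allocation that is IR, weakly Pareto optimal and has no strong justified envy by exchange. 3. If every $u^i$ is linear, there is an allocation that is IR, Pareto optimal and has no strong justified envy by exchange. (B) Suppose that every $u^i$ is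 quasi-concave and that at least one of the following holds: - $\sum_l q_l<\min_i c^i$, and every $u^i$ is strongly monotone; - for every $i$, $u^i(x)=u^i(0)$ for all $x\in C^i$ that have a zero coordinate (Inada property), and $\tilde u^i>u^i(0)$; - there is an IR allocation $\tilde x$ with $\tilde x^i_l>0$ for all $i,l$, and there is an object $l$ such that, for every $i$ and every $k\ne l$, moving any amount $\epsilon>0$ of consumption from $k$ to $l$ within $C^i$ strictly increases $u^i$ (common favorite object). Then, with $\Delta=\{p\in\mathbb R_+^O:\sum_l p_l=1\}$, there are continuous functions $m^i:\Delta\to\mathbb R_+$ ($i\in I$), a price vector $p\in\Delta$ and an allocation $x$ such that $x$ is IR, Pareto optimal and has no justified envy by exchange, and $x^i\in\operatorname{argmax}\{u^i(z):z\in C^i,\ p\cdot z\le m^i(p)\}$ for every $i$. -/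

import Mathlib

/-- An allocation problem with agents `I` and objects `O`. -/
structure AllocationProblem (I O : Type*) [Fintype I] [Fintype O] where
  /-- capacities -/
  q : O → ℝ
  /-- maximum overall demands -/
  c : I → ℝ
  /-- utility functions; only the values on the consumption space of the agent matter,
  see `AllocationProblem.U` -/
  u : I → (O → ℝ) → ℝ
  /-- reservation utilities -/
  r : I → ℝ
  q_pos : ∀ l, 0 < q l
  c_pos : ∀ i, 0 < c i
  no_excess_supply : ∑ l, q l ≤ ∑ i, c i
  continuous_u : ∀ i, ContinuousOn (u i) {x : O → ℝ | 0 ≤ x ∧ ∑ l, x l ≤ c i}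
  /-- Utility increases when the consumption of *every* object increases. The stronger
  requirement that it increases when the consumption of *some* objects increases and that of
  no object decreases (`AllocationProblem.StronglyMonotone`) is imposed separately where it is
  needed, because it contradicts the Inada property as soon as there are two objects. -/
  monotone_u : ∀ i, ∀ x y : O → ℝ, 0 ≤ x → ∑ l, y l ≤ c i → (∀ l, x l < y l) → u i x < u i y

namespace AllocationProblem

variable {I O : Type*} [Fintype I] [Fintype O] (Γ : AllocationProblem I O)

/-- The consumption space of agent `i`. -/
def C (i : I) : Set (O → ℝ) := {x | 0 ≤ x ∧ ∑ l, x l ≤ Γ.c i}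

open Classical in
/-- The utility function of agent `i` as an extended real valued function on all bundles:
it is `-∞` outside the consumption space. -/
noncomputable def U (i : I) (x : O → ℝ) : EReal := if x ∈ Γ.C i then (Γ.u i x : EReal) else ⊥

/-- An allocation: every agent gets a bundle in her consumption space, and all objects are
distributed. -/
def IsAllocation (x : I → O → ℝ) : Prop :=
  (∀ i, x i ∈ Γ.C i) ∧ ∀ l, ∑ i, x i l = Γ.q l

/-- `ε`-individual rationality. -/
def IsApproxIR (ε : ℝ) (x : I → O → ℝ) : Prop :=
  ∀ i, ((Γ.r i - ε : ℝ) : EReal) ≤ Γ.U i (x i)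

/-- Individual rationality. -/
def IsIR (x : I → O → ℝ) : Prop := ∀ i, (Γ.r i : EReal) ≤ Γ.U i (x i)

/-- `ε`-Pareto optimality. -/
def IsApproxPO (ε : ℝ) (x : I → O → ℝ) : Prop :=
  ¬ ∃ y, Γ.IsAllocation y ∧ ∀ i, Γ.U i (x i) + (ε : EReal) < Γ.U i (y i)

/-- Weak Pareto optimality. -/
def IsWeaklyPO (x : I → O → ℝ) : Prop :=
  ¬ ∃ y, Γ.IsAllocation y ∧ ∀ i, Γ.U i (x i) < Γ.U i (y i)

/-- Pareto optimality. -/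
def IsPO (x : I → O → ℝ) : Prop :=
  ¬ ∃ y, Γ.IsAllocation y ∧ (∀ i, Γ.U i (x i) ≤ Γ.U i (y i)) ∧ ∃ i, Γ.U i (x i) < Γ.U i (y i)

/-- Agent `i` envies agent `j` at `x`. -/
def Envies (x : I → O → ℝ) (i j : I) : Prop := Γ.U i (x i) < Γ.U i (x j)

/-- A chain of exchanges at `x`: a sequence of distinct agents whose first two members are `i`
and `j`, each of whom envies the next one, and whose last member is `k`. -/
def EnvyChain (x : I → O → ℝ) (i j k : I) : Prop :=
  ∃ (K : ℕ) (s : Fin (K + 2) → I), Function.Injective s ∧ s 0 = i ∧ s 1 = j ∧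
    s (Fin.last (K + 1)) = k ∧ ∀ t : Fin (K + 1), Γ.Envies x (s t.castSucc) (s t.succ)

/-- Agent `i` has justified envy by exchange towards agent `j` at `x`. -/
def JustifiedEnvyByExchange (x : I → O → ℝ) (i j : I) : Prop :=
  ∃ k, Γ.EnvyChain x i j k ∧ (Γ.r k : EReal) ≤ Γ.U k (x i)

/-- Agent `i` has strong justified envy by exchange towards agent `j` at `x`. -/
def StrongJustifiedEnvyByExchange (x : I → O → ℝ) (i j : I) : Prop :=
  ∃ k, Γ.EnvyChain x i j k ∧ (Γ.r k : EReal) < Γ.U k (x i)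

/-- Agent `i` has `ε`-justified envy by exchange towards agent `j` at `x`. -/
def ApproxJustifiedEnvyByExchange (ε : ℝ) (x : I → O → ℝ) (i j : I) : Prop :=
  ∃ k, Γ.EnvyChain x i j k ∧ ((Γ.r k - ε : ℝ) : EReal) < Γ.U k (x i)

/-- Every utility function is linear on its domain. -/
def IsLinear : Prop := ∀ i, ∃ v : O → ℝ, ∀ x ∈ Γ.C i, Γ.u i x = ∑ l, v l * x l

/-- Every utility function is strictly increasing for the componentwise order: here `x < y`
means that `x l ≤ y l` for all `l` and `x ≠ y`. -/
def StronglyMonotone : Prop := ∀ i, StrictMonoOn (Γ.u i) (Γ.C i)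

/-- The Inada property at the axes of the utility function of agent `i`. -/
def Inada (i : I) : Prop := ∀ x ∈ Γ.C i, ¬ (∀ l, 0 < x l) → Γ.u i x = Γ.u i 0

/-- Object `l` is a favorite object of agent `i`: replacing a positive amount of another object
by the same amount of `l` increases utility. -/
def IsFavorite (i : I) (l : O) : Prop :=
  ∀ x ∈ Γ.C i, ∀ y ∈ Γ.C i, ∀ k, k ≠ l → ∀ ε : ℝ, 0 < ε → y k = x k - ε → y l = x l + ε →
    (∀ h, h ≠ k → h ≠ l → y h = x h) → Γ.u i x < Γ.u i y

/-- The bundles in the consumption space of agent `i` that she can afford at prices `p` with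
income `w`. -/
def budget (i : I) (p : O → ℝ) (w : ℝ) : Set (O → ℝ) := {z ∈ Γ.C i | ∑ l, p l * z l ≤ w}

end AllocationProblem

/-! The allocation is an equilibrium with endogenous incomes. At prices `p` all agents receive a
common basic income `M`, raised for each agent to the least cost of a bundle that she accepts. An
agent who envies another has the smaller income. If she accepts another's bundle, that bundle costs
at least her reservation cost, so its owner's income is at least hers. Incomes rise strictly along
an envy chain, so the last agent cannot accept the first agent's bundle: there is no justified envy
by exchange. Pareto optimality is the first welfare theorem, made valid under satiation by letting
nobody spend more than the cheapest satiating bundle costs.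

For existence, `M` is chosen by the intermediate value theorem so that total spending is the value
of the supply, unless everybody can be satiated for less. The basic income need not be unique, but
the spending is, and it is continuous in `p`. Demand is weakened to `quasiDemand`, where only
strictly cheaper bundles must not be better. Its excess demand is convex valued with compact graph,
so `exists_le_inner_of_isCompact_graph`, a form of Kakutani's theorem derived here from Scarf's
lemma through a closed covering of the simplex, gives `exists_quasiEquilibrium`.

At a positive income quasi-demand is demand. In (B) each alternative excludes the trouble at zero
income. In (A) the reservation utilities are lowered slightly; this forces `M > 0`, and a limit is
taken. Weak Pareto optimality and absence of strong justified envy survive the limit. -/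

/-! ### Scarf's lemma, by a parity argument. -/

section Scarf

open Finset

variable {X I α : Type*} [LinearOrder α]

/-- A set of points is dominant for a family of rankings if no point beats all its elements in
every ranking. -/
def IsDominant (f : I → X → α) (σ : Finset X) : Prop :=
  ∀ x, ∃ i, ∀ y ∈ σ, f i x ≤ f i y

theorem IsDominant.subset {f : I → X → α} {σ τ : Finset X} (h : IsDominant f σ) (hτ : τ ⊆ σ) :
    IsDominant f τ := fun x => (h x).imp fun _ hi y hy => hi y (hτ hy)

/-- Removing an element from a set that does not carry all colors leaves exactly the colors
different from `i` for an even number of choices of that element. -/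
theorem even_card_erase_image_eq [DecidableEq X] [Fintype I] [DecidableEq I] (c : X → I)
    (i : I) {σ : Finset X}
    (hcard : #σ = Fintype.card I) (hσ : σ.image c ≠ univ) :
    Even #{x ∈ σ | (σ.erase x).image c = univ.erase i} := by
  by_cases hex : ∃ x₀ ∈ σ, (σ.erase x₀).image c = univ.erase i
  swap
  · push Not at hex
    rw [filter_false_of_mem hex]
    simp
  obtain ⟨x₀, hx₀, himg⟩ := hex
  have hinj : Set.InjOn c (σ.erase x₀ : Finset X) := by
    rw [← card_image_iff, himg, card_erase_of_mem hx₀, card_erase_of_mem (mem_univ _), card_univ,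
      hcard]
  -- The color `i` is absent from `σ`, so `x₀` shares its color with exactly one other element `x₁`.
  -- Only these two can be removed.
  have hc₀ : c x₀ ∈ univ.erase i := by
    refine mem_erase.2 ⟨fun h => hσ ?_, mem_univ _⟩
    rw [← insert_erase hx₀, image_insert, himg, h, insert_erase (mem_univ _)]
  obtain ⟨x₁, hx₁, hcx⟩ := mem_image.1 (himg ▸ hc₀)
  have hx₁' := mem_erase.1 hx₁
  have : ({x ∈ σ | (σ.erase x).image c = univ.erase i} : Finset X) = {x₀, x₁} := by
    ext x
    simp only [mem_filter, mem_insert, mem_singleton]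
    constructor
    · rintro ⟨hx, hximg⟩
      by_contra hne
      push Not at hne
      have h1 : x ∈ σ.erase x₀ := mem_erase.2 ⟨hne.1, hx⟩
      have h2 : c x ∈ univ.erase i := himg ▸ mem_image_of_mem c h1
      obtain ⟨y, hy, hyx⟩ := mem_image.1 (hximg ▸ h2)
      rw [mem_erase] at hy
      by_cases hy₀ : y = x₀
      · subst hy₀
        exact hne.2 (hinj h1 hx₁ (hyx.symm.trans hcx.symm))
      · exact hy.1 (hinj (mem_erase.2 ⟨hy₀, hy.2⟩) h1 hyx)
    · rintro (rfl | rfl)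
      · exact ⟨hx₀, himg⟩
      · refine ⟨hx₁'.2, ?_⟩
        ext g
        constructor
        · intro hg
          obtain ⟨y, hy, rfl⟩ := mem_image.1 hg
          by_cases hy₀ : y = x₀
          · rwa [hy₀]
          · exact himg ▸ mem_image_of_mem c (mem_erase.2 ⟨hy₀, (mem_erase.1 hy).2⟩)
        · intro hg
          obtain ⟨y, hy, rfl⟩ := mem_image.1 (himg ▸ hg)
          by_cases hy₁ : y = x
          · subst hy₁
            rw [hcx]
            exact mem_image_of_mem c (mem_erase.2 ⟨hx₁'.1.symm, hx₀⟩)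
          · exact mem_image_of_mem c (mem_erase.2 ⟨hy₁, (mem_erase.1 hy).2⟩)
  rw [this, card_pair hx₁'.1.symm]
  exact even_two

variable [Fintype X] [DecidableEq X] [Fintype I] [DecidableEq I]

/-- A dominant set that is one element short of the number of rankings, and does not consist of
slack points only, extends to a full dominant set in exactly two ways. -/
theorem IsDominant.card_extensions {f : I → X → α} (hf : ∀ i, Function.Injective (f i))
    {s : I → X} (hs : Function.Injective s)
    (hs_min : ∀ i x, x ≠ s i → f i (s i) < f i x)
    (hs_max : ∀ i j x, j ≠ i → x ∉ Set.range s → f i x < f i (s j))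
    {τ : Finset X} (hτ : IsDominant f τ) (hcard : #τ + 1 = Fintype.card I)
    (hne : ∀ i, τ ≠ (univ.erase i).image s) :
    ∃ a b, a ≠ b ∧ ∀ x, (x ∉ τ ∧ IsDominant f (insert x τ)) ↔ x = a ∨ x = b := by
  classical
  have hI : Nonempty I := Fintype.card_pos_iff.1 (by omega)
  have hτne : τ.Nonempty := by
    rw [nonempty_iff_ne_empty]
    rintro rfl
    obtain ⟨i⟩ := hI
    apply hne i
    symm
    rw [image_eq_empty, ← card_eq_zero, card_erase_of_mem (mem_univ _), card_univ]
    simp at hcard; omega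
  have hmin : ∀ i, ∃ y ∈ τ, ∀ z ∈ τ, f i y ≤ f i z := fun i => exists_min_image τ (f i) hτne
  choose μ hμ hμ' using hmin
  have hsurj : ∀ y ∈ τ, ∃ i, μ i = y := fun y hy => by
    obtain ⟨i, hi⟩ := hτ y
    exact ⟨i, hf i (le_antisymm (hμ' i y hy) (hi _ (hμ i)))⟩
  -- Dominance makes every element of `τ` the minimum of some ranking. There is one more ranking
  -- than elements, so exactly one pair `i`, `j` shares its minimum; a new element must take over
  -- one of these two rankings.
  obtain ⟨i, -, j, -, hij, hμij⟩ := exists_ne_map_eq_of_card_lt_of_maps_to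
    (s := (univ : Finset I)) (t := τ) (f := μ) (by rw [card_univ]; omega) (fun i _ => hμ i)
  have key : ∀ k, k = i ∨ k = j → ∃ a, (∀ h, h ≠ k → f h (μ h) < f h a) ∧ f k a < f k (μ k) ∧
      ∀ x, (x ∉ τ ∧ IsDominant f (insert x τ) ∧ ∀ h, h ≠ k → f h (μ h) < f h x) ↔ x = a := by
    intro k hk
    have hsurj' : ∀ y ∈ τ, ∃ h, h ≠ k ∧ μ h = y := by
      intro y hy
      obtain ⟨h, rfl⟩ := hsurj y hy
      by_cases hhk : h = k
      · subst hhk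
        rcases hk with rfl | rfl
        · exact ⟨j, hij.symm, hμij.symm⟩
        · exact ⟨i, hij, hμij⟩
      · exact ⟨h, hhk, rfl⟩
    -- The candidates for taking over `k` beat the minimum of `τ` in every other ranking; the best
    -- of them for `f k` is the only one that works. If `s k` were not a candidate, `τ` would
    -- consist of all slack points but one.
    have hM : s k ∈ ({x | ∀ h, h ≠ k → f h (μ h) < f h x} : Finset X) := by
      simp only [mem_filter, mem_univ, true_and]
      intro h hhk
      by_contra hlt
      rw [not_lt] at hlt
      apply hne h
      apply eq_of_subset_of_card_le
      · intro y hy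
        have h1 := hlt.trans (hμ' h y hy)
        by_cases hy' : y ∈ Set.range s
        · obtain ⟨g, rfl⟩ := hy'
          refine mem_image_of_mem _ (mem_erase.2 ⟨?_, mem_univ _⟩)
          rintro rfl
          exact (hs_min g _ fun h2 => hhk.symm (hs h2)).not_ge h1
        · exact absurd (hs_max h k y hhk.symm hy') h1.not_gt
      · refine card_image_le.trans ?_
        rw [card_erase_of_mem (mem_univ _), card_univ]; omega
    obtain ⟨a, ha, hamax⟩ := exists_max_image _ (f k) ⟨_, hM⟩
    simp only [mem_filter, mem_univ, true_and] at ha hamax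
    have hnotin : ∀ x, (∀ h, h ≠ k → f h (μ h) < f h x) → x ∉ τ := by
      intro x hx hxτ
      obtain ⟨h, hhk, rfl⟩ := hsurj' x hxτ
      exact lt_irrefl _ (hx h hhk)
    have hlt : ∀ x, (∀ h, h ≠ k → f h (μ h) < f h x) → f k x < f k (μ k) := by
      intro x hx
      obtain ⟨h, hh⟩ := hτ x
      obtain rfl : h = k := by
        by_contra hhk
        exact (hx h hhk).not_ge (hh _ (hμ h))
      refine lt_of_le_of_ne (hh _ (hμ h)) fun h1 => hnotin x hx ?_
      rw [hf _ h1]; exact hμ h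
    refine ⟨a, ha, hlt a ha, fun x => ⟨?_, ?_⟩⟩
    · rintro ⟨-, hdom, hx⟩
      obtain ⟨h, hh⟩ := hdom a
      obtain rfl : h = k := by
        by_contra hhk
        exact (ha h hhk).not_ge (hh _ (mem_insert_of_mem (hμ h)))
      exact hf h (le_antisymm (hamax x hx) (hh x (mem_insert_self _ _)))
    · rintro rfl
      refine ⟨hnotin x ha, fun y => ?_, ha⟩
      by_cases hy : ∀ h, h ≠ k → f h (μ h) < f h y
      · refine ⟨k, fun z hz => ?_⟩
        rcases mem_insert.1 hz with rfl | hz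
        · exact hamax y hy
        · exact (hlt y hy).le.trans (hμ' k z hz)
      · push Not at hy
        obtain ⟨h, hhk, hle⟩ := hy
        refine ⟨h, fun z hz => ?_⟩
        rcases mem_insert.1 hz with rfl | hz
        · exact hle.trans (ha h hhk).le
        · exact hle.trans (hμ' h z hz)
  obtain ⟨a, ha, ha', hauniq⟩ := key i (Or.inl rfl)
  obtain ⟨b, hb, hb', hbuniq⟩ := key j (Or.inr rfl)
  refine ⟨a, b, ?_, fun x => ⟨?_, ?_⟩⟩
  · rintro rfl
    exact (ha j hij.symm).not_gt hb'
  -- In the extended set the minimizers `ν` are a bijection. If `x` took over neither `i` nor `j`,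
  -- these two rankings would keep their common minimum.
  · rintro ⟨hx, hdom⟩
    rw [← hauniq, ← hbuniq]
    by_contra hcon
    push Not at hcon
    obtain ⟨h₁, h₁i, h₁x⟩ := hcon.1 hx hdom
    obtain ⟨h₂, h₂j, h₂x⟩ := hcon.2 hx hdom
    choose ν hν hν' using fun h => exists_min_image (insert x τ) (f h) ⟨x, mem_insert_self _ _⟩
    have hνsurj : ∀ y ∈ insert x τ, ∃ h, ν h = y := fun y hy => by
      obtain ⟨h, hh⟩ := hdom y
      exact ⟨h, hf h (le_antisymm (hν' h y hy) (hh _ (hν h)))⟩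
    have hνinj : ∀ g h, ν g = ν h → g = h := by
      have h1 : Set.SurjOn ν (univ : Finset I) (insert x τ : Finset X) := by
        intro y hy
        obtain ⟨h, hh⟩ := hνsurj y hy
        exact ⟨h, by simp, hh⟩
      have h2 := injOn_of_surjOn_of_card_le ν (fun h _ => hν h) h1
        (by rw [card_univ, card_insert_of_notMem hx]; omega)
      intro g h hgh
      exact h2 (by simp) (by simp) hgh
    have hνx : ∀ h, f h x ≤ f h (μ h) → ν h = x := by
      intro h hle
      refine hf h (le_antisymm (hν' h x (mem_insert_self _ _)) ?_)
      rcases mem_insert.1 (hν h) with h3 | h3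
      · rw [h3]
      · exact hle.trans (hμ' h _ h3)
    have hνμ : ∀ h, f h (μ h) < f h x → ν h = μ h := by
      intro h hlt
      refine hf h (le_antisymm (hν' h _ (mem_insert_of_mem (hμ h))) ?_)
      rcases mem_insert.1 (hν h) with h3 | h3
      · rw [h3]; exact hlt.le
      · exact hμ' h _ h3
    have e : h₁ = h₂ := hνinj _ _ ((hνx _ h₁x).trans (hνx _ h₂x).symm)
    have hothers : ∀ h, h ≠ h₁ → ν h = μ h := by
      intro h hh
      apply hνμ
      by_contra hle
      exact hh (hνinj _ _ ((hνx _ (not_lt.1 hle)).trans (hνx _ h₁x).symm))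
    exact hij (hνinj _ _ (by rw [hothers i h₁i.symm, hothers j (e ▸ h₂j.symm), hμij]))
  · rintro (rfl | rfl)
    · exact ⟨((hauniq x).2 rfl).1, ((hauniq x).2 rfl).2.1⟩
    · exact ⟨((hbuniq x).2 rfl).1, ((hbuniq x).2 rfl).2.1⟩

/-- A set made of all slack points but one extends to a full dominant set in exactly one way. -/
theorem exists_unique_extension_slack {f : I → X → α} (hf : ∀ i, Function.Injective (f i))
    {s : I → X} (hs : Function.Injective s) (hs_min : ∀ i x, x ≠ s i → f i (s i) < f i x)
    (hs_max : ∀ i j x, j ≠ i → x ∉ Set.range s → f i x < f i (s j)) (i : I) :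
    ∃ a, ∀ x, (x ∉ (univ.erase i).image s ∧ IsDominant f (insert x ((univ.erase i).image s))) ↔
      x = a := by
  have hmem : ∀ x, x ∉ (univ.erase i).image s ↔ ∀ j, j ≠ i → x ≠ s j := by
    intro x
    simp only [mem_image, mem_erase, mem_univ, and_true, not_exists, not_and]
    exact forall₂_congr fun j _ => ⟨Ne.symm, Ne.symm⟩
  have hsi : s i ∈ ({x | x ∉ (univ.erase i).image s} : Finset X) := by
    rw [mem_filter, hmem]
    exact ⟨mem_univ _, fun j hj h => hj (hs h).symm⟩
  have hle : ∀ x, x ∉ (univ.erase i).image s → ∀ j, j ≠ i → f i x ≤ f i (s j) := by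
    intro x hx j hj
    rw [hmem] at hx
    by_cases hxs : x ∈ Set.range s
    · obtain ⟨k, rfl⟩ := hxs
      obtain rfl : k = i := by
        by_contra hk
        exact hx k hk rfl
      exact (hs_min k _ fun h => hj (hs h)).le
    · exact (hs_max i j x hj hxs).le
  obtain ⟨a, ha, hamax⟩ := exists_max_image _ (f i) ⟨_, hsi⟩
  simp only [mem_filter, mem_univ, true_and] at ha hamax
  refine ⟨a, fun x => ⟨?_, ?_⟩⟩
  · rintro ⟨hx, hdom⟩
    obtain ⟨h, hh⟩ := hdom a
    obtain rfl : h = i := by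
      by_contra hhi
      have h1 := hh (s h) (mem_insert_of_mem (mem_image_of_mem _ (mem_erase.2 ⟨hhi, mem_univ _⟩)))
      exact (hs_min h a ((hmem a).1 ha h hhi)).not_ge h1
    exact hf h (le_antisymm (hamax x hx) (hh x (mem_insert_self _ _)))
  · rintro rfl
    refine ⟨ha, fun y => ?_⟩
    by_cases hy : y ∉ (univ.erase i).image s
    · refine ⟨i, fun z hz => ?_⟩
      rcases mem_insert.1 hz with rfl | hz
      · exact hamax y hy
      · obtain ⟨j, hj, rfl⟩ := mem_image.1 hz
        exact hle y hy j (mem_erase.1 hj).1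
    · rw [not_not] at hy
      obtain ⟨j, -, rfl⟩ := mem_image.1 hy
      refine ⟨j, fun z _ => ?_⟩
      by_cases hz : z = s j
      · rw [hz]
      · exact (hs_min j z hz).le

/-- **Scarf's lemma**: if a finite set is ranked by finitely many injective functions and
contains slack points, and its points are colored by the rankings so that the colors of the slack
points are their own indices, then there is a dominant set that carries every color once. -/
theorem exists_dominant_colorful [Nonempty I] {f : I → X → α}
    (hf : ∀ i, Function.Injective (f i)) {s : I → X}
    (hs_min : ∀ i x, x ≠ s i → f i (s i) < f i x)
    (hs_max : ∀ i j x, j ≠ i → x ∉ Set.range s → f i x < f i (s j))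
    (c : X → I) (hc : ∀ i, c (s i) = i) :
    ∃ σ : Finset X, #σ = Fintype.card I ∧ IsDominant f σ ∧ σ.image c = univ := by
  classical
  have hs : Function.Injective s := fun i j h => by rw [← hc i, ← hc j, h]
  have hcs : c ∘ s = id := funext hc
  by_contra hcon
  push Not at hcon
  obtain ⟨i⟩ := ‹Nonempty I›
  let R : Finset (Finset X) := {σ | #σ = Fintype.card I ∧ IsDominant f σ}
  let D : Finset (Finset X) := {τ | #τ + 1 = Fintype.card I ∧ τ.image c = univ.erase i}
  -- The pairs `τ ⊆ σ` are counted twice. If no `σ` is colorful, each contains an even number of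
  -- `τ`; but each `τ` has zero or two extensions, except `τ₀`, which has one.
  have hcount := sum_card_bipartiteAbove_eq_sum_card_bipartiteBelow (s := D) (t := R) (· ⊆ ·)
  have hR : Even (∑ σ ∈ R, #(bipartiteBelow (· ⊆ ·) D σ)) := by
    refine even_sum _ fun σ hσ => ?_
    obtain ⟨h1, h2⟩ := (mem_filter.1 hσ).2
    have : bipartiteBelow (· ⊆ ·) D σ =
        ({x ∈ σ | (σ.erase x).image c = univ.erase i} : Finset X).image σ.erase := by
      ext τ
      simp only [mem_bipartiteBelow, D, mem_filter, mem_univ, true_and, mem_image]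
      constructor
      · rintro ⟨⟨h3, h4⟩, h5⟩
        have h6 : #(σ \ τ) = 1 := by rw [card_sdiff_of_subset h5]; omega
        obtain ⟨x, hx⟩ := card_eq_one.1 h6
        have h7 : σ.erase x = τ := by
          rw [← sdiff_singleton_eq_erase, ← hx, Finset.sdiff_sdiff_eq_self h5]
        have h8 : x ∈ σ := (mem_sdiff.1 (hx ▸ mem_singleton_self x : x ∈ σ \ τ)).1
        exact ⟨x, ⟨h8, h7 ▸ h4⟩, h7⟩
      · rintro ⟨x, ⟨h3, h4⟩, rfl⟩
        refine ⟨⟨?_, h4⟩, erase_subset _ _⟩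
        rw [card_erase_of_mem h3]
        have := card_pos.2 ⟨x, h3⟩
        omega
    rw [this, card_image_of_injOn]
    · exact even_card_erase_image_eq c i h1 (hcon σ h1 h2)
    · intro x hx y hy hxy
      exact erase_injOn σ (mem_filter.1 hx).1 (mem_filter.1 hy).1 hxy
  have habove : ∀ τ ∈ D, #(bipartiteAbove (· ⊆ ·) R τ) =
      #({x | x ∉ τ ∧ IsDominant f (insert x τ)} : Finset X) := by
    intro τ hτ
    obtain ⟨h1, -⟩ := (mem_filter.1 hτ).2
    have : bipartiteAbove (· ⊆ ·) R τ =
        ({x | x ∉ τ ∧ IsDominant f (insert x τ)} : Finset X).image (insert · τ) := by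
      ext σ
      simp only [mem_bipartiteAbove, R, mem_filter, mem_univ, true_and, mem_image]
      constructor
      · rintro ⟨⟨h3, h4⟩, h5⟩
        have h6 : #(σ \ τ) = 1 := by rw [card_sdiff_of_subset h5]; omega
        obtain ⟨x, hx⟩ := card_eq_one.1 h6
        have h7 : insert x τ = σ := by
          rw [insert_eq, ← hx, sdiff_union_of_subset h5]
        have h8 : x ∉ τ := (mem_sdiff.1 (hx ▸ mem_singleton_self x : x ∈ σ \ τ)).2
        exact ⟨x, ⟨h8, h7 ▸ h4⟩, h7⟩
      · rintro ⟨x, ⟨h3, h4⟩, rfl⟩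
        exact ⟨⟨by rw [card_insert_of_notMem h3, h1], h4⟩, subset_insert _ _⟩
    rw [this, card_image_of_injOn]
    intro x hx y hy hxy
    have h2 : x ∈ insert y τ := by
      have : x ∈ insert x τ := mem_insert_self _ _
      simpa only [hxy] using this
    exact (mem_insert.1 h2).resolve_right (mem_filter.1 hx).2.1
  let τ₀ := (univ.erase i).image s
  have hτ₀ : τ₀ ∈ D := by
    refine mem_filter.2 ⟨mem_univ _, ?_, ?_⟩
    · rw [card_image_of_injective _ hs, card_erase_of_mem (mem_univ _), card_univ]
      have : 0 < Fintype.card I := Fintype.card_pos_iff.2 ⟨i⟩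
      omega
    · rw [image_image, hcs, image_id]
  rw [← hcount, ← add_sum_erase _ _ hτ₀, habove _ hτ₀] at hR
  obtain ⟨a, ha⟩ := exists_unique_extension_slack hf hs hs_min hs_max i
  have h1 : ({x | x ∉ τ₀ ∧ IsDominant f (insert x τ₀)} : Finset X) = {a} := by
    ext x
    simp only [mem_filter, mem_univ, true_and, mem_singleton]
    exact ha x
  rw [h1, card_singleton, Nat.even_add] at hR
  have h2 : Even (∑ τ ∈ D.erase τ₀, #(bipartiteAbove (· ⊆ ·) R τ)) := by
    refine even_sum _ fun τ hτ => ?_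
    obtain ⟨hτne, hτD⟩ := mem_erase.1 hτ
    obtain ⟨h3, h4⟩ := (mem_filter.1 hτD).2
    rw [habove τ hτD]
    by_cases hdom : IsDominant f τ
    · have hne : ∀ j, τ ≠ (univ.erase j).image s := by
        rintro j rfl
        have h5 : (univ.erase j : Finset I) = univ.erase i := by
          rw [← h4, image_image, hcs, image_id]
        have h6 : j = i := by
          by_contra hji
          have : j ∈ univ.erase i := mem_erase.2 ⟨hji, mem_univ _⟩
          rw [← h5] at this
          exact (mem_erase.1 this).1 rfl
        exact hτne (h6 ▸ rfl)
      obtain ⟨a, b, hab, h5⟩ := hdom.card_extensions hf hs hs_min hs_max h3 hne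
      have h6 : ({x | x ∉ τ ∧ IsDominant f (insert x τ)} : Finset X) = {a, b} := by
        ext x
        simp only [mem_filter, mem_univ, true_and, mem_insert, mem_singleton]
        exact h5 x
      rw [h6, card_pair hab]
      exact even_two
    · rw [filter_false_of_mem fun x _ h => hdom (h.2.subset (subset_insert _ _))]
      simp
  exact absurd (hR.2 h2) (by decide)

end Scarf

/-! ### From Scarf's lemma to closed coverings of the simplex. -/

section ClosedCover

open Finset Filter Topology

/-- A coloring of the grid points of a simplex by its vertices has a cluster of grid points whose
colors are exactly the vertices in `C`, such that the coordinates outside of `C` are small. -/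
theorem exists_colorful_cluster {I : Type*} [Fintype I] [Nonempty I] (N : ℕ)
    (c : (I → ℕ) → I) :
    ∃ (C : Finset I) (x : I → I → ℕ), C.Nonempty ∧
      (∀ i ∈ C, ∑ l, x i l = N ∧ c (x i) = i) ∧
      (∀ i ∈ C, ∀ j ∈ C, ∀ l, x i l < x j l + Fintype.card I) ∧
      ∀ i ∈ C, ∀ l, l ∉ C → x i l < Fintype.card I := by
  classical
  let G := {v : I → Fin (N + 1) // ∑ l, (v l : ℕ) = N}
  let X := G ⊕ I
  let val : X → I → ℤ := fun x i => match x with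
    | Sum.inl v => (v.1 i : ℕ)
    | Sum.inr j => if i = j then -1 else N + 1
  let m := Fintype.card X
  let e : X ≃ Fin m := Fintype.equivFin X
  -- Points are ranked by their coordinates; since `e x < m`, the enumeration only breaks ties.
  let f : I → X → ℤ := fun i x => val x i * m + (e x : ℕ)
  have he : ∀ x, ((e x : ℕ) : ℤ) < m := fun x => by exact_mod_cast (e x).2
  have he0 : ∀ x, (0 : ℤ) ≤ ((e x : ℕ) : ℤ) := fun x => Int.natCast_nonneg _
  have hlt : ∀ i x y, val x i < val y i → f i x < f i y := by
    intro i x y h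
    have h1 := he x
    have h2 := he0 y
    have h3 : (val x i + 1) * (m : ℤ) ≤ val y i * m :=
      mul_le_mul_of_nonneg_right (by omega) (by positivity)
    simp only [f]
    linarith
  have hf : ∀ i, Function.Injective (f i) := by
    intro i x y hxy
    have h1 : val x i = val y i := by
      rcases lt_trichotomy (val x i) (val y i) with h | h | h
      · exact absurd hxy (hlt i x y h).ne
      · exact h
      · exact absurd hxy (hlt i y x h).ne'
    simp only [f, h1] at hxy
    apply e.injective
    ext
    omega
  let s : I → X := Sum.inr
  let c' : X → I := fun x => match x with
    | Sum.inl v => c fun l => (v.1 l : ℕ)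
    | Sum.inr j => j
  have hs_min : ∀ i x, x ≠ s i → f i (s i) < f i x := by
    intro i x hx
    refine hlt i (s i) x ?_
    rcases x with v | j
    · simp [val, s]
      omega
    · have hij : i ≠ j := fun h => hx (by rw [h])
      simp [val, s, hij]
  have hs_max : ∀ i j x, j ≠ i → x ∉ Set.range s → f i x < f i (s j) := by
    intro i j x hji hx
    refine hlt i x (s j) ?_
    rcases x with v | k
    · have := (v.1 i).2
      simp only [val, s, hji.symm, if_false]
      omega
    · exact absurd ⟨k, rfl⟩ hx
  obtain ⟨σ, hcard, hdom, himg⟩ := exists_dominant_colorful hf hs_min hs_max c' (fun _ => rfl)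
  have hinj : Set.InjOn c' σ := by
    rw [← card_image_iff, himg, hcard, card_univ]
  let C : Finset I := {i | s i ∉ σ}
  have hC : ∀ i ∈ C, ∃ v : G, Sum.inl v ∈ σ ∧ c' (Sum.inl v) = i := by
    intro i hi
    obtain ⟨x, hx, hxi⟩ := mem_image.1 (himg ▸ mem_univ i)
    rcases x with v | j
    · exact ⟨v, hx, hxi⟩
    · have : j = i := hxi
      subst this
      exact absurd hx (mem_filter.1 hi).2
  have hC' : ∀ v : G, ∃ i ∈ C, ∀ w : G, Sum.inl w ∈ σ → (v.1 i : ℕ) ≤ w.1 i := by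
    intro v
    obtain ⟨i, hi⟩ := hdom (Sum.inl v)
    refine ⟨i, mem_filter.2 ⟨mem_univ _, fun h => ?_⟩, fun w hw => ?_⟩
    · exact (hs_min i (Sum.inl v) (by simp [s])).not_ge (hi _ h)
    · by_contra hlt'
      refine (hlt i (Sum.inl w) (Sum.inl v) ?_).not_ge (hi _ hw)
      simp only [val]
      omega
  have hG : Nonempty G := by
    obtain ⟨i₀⟩ := ‹Nonempty I›
    exact ⟨⟨fun l => if l = i₀ then ⟨N, by omega⟩ else 0, by
      rw [sum_eq_single i₀] <;> simp +contextual⟩⟩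
  choose! x hxσ hxc using hC
  have hCne : C.Nonempty := by
    obtain ⟨v⟩ := hG
    obtain ⟨i, hi, -⟩ := hC' v
    exact ⟨i, hi⟩
  choose j hjC hjmin using fun i => exists_min_image C (fun j => ((x j).1 i : ℕ)) hCne
  let a : I → ℕ := fun i => (x (j i)).1 i
  -- Otherwise some grid point would exceed the minima `a i` in all coordinates of `C`, against
  -- dominance. As all coordinate sums are `N`, this bounds both the spread inside `C` and the mass
  -- outside it.
  have hsum : N < ∑ i ∈ C, (a i + 1) := by
    by_contra hle
    rw [not_lt] at hle
    obtain ⟨i₀, hi₀⟩ := hCne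
    let w : I → ℕ := fun i => (if i ∈ C then a i + 1 else 0) +
      if i = i₀ then N - ∑ i ∈ C, (a i + 1) else 0
    have hw : ∑ i, w i = N := by
      simp only [w, sum_add_distrib, sum_ite_mem, univ_inter, sum_ite_eq', mem_univ, if_true]
      simp only [sum_add_distrib] at hle
      omega
    have hw' : ∀ i, w i < N + 1 := fun i => by
      rw [← hw, Nat.lt_succ_iff]
      exact single_le_sum (f := w) (fun _ _ => Nat.zero_le _) (mem_univ i)
    obtain ⟨i, hi, hmin⟩ := hC' ⟨fun i => ⟨w i, hw' i⟩, hw⟩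
    have h1 := hmin (x (j i)) (hxσ _ (hjC i))
    simp only [w, hi, if_true, a] at h1
    omega
  have hsum' : ∀ k ∈ C, ∑ i ∈ C, (((x k).1 i : ℕ) - a i) + ∑ i ∈ univ \ C, ((x k).1 i : ℕ) <
      Fintype.card I := by
    intro k hk
    have h1 : ∑ i ∈ C, (((x k).1 i : ℕ) - a i) + ∑ i ∈ C, a i = ∑ i ∈ C, ((x k).1 i : ℕ) := by
      rw [← sum_add_distrib]
      refine sum_congr rfl fun i _ => Nat.sub_add_cancel ?_
      exact hjmin i k hk
    have h2 := sum_sdiff (f := fun i => ((x k).1 i : ℕ)) (subset_univ C)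
    have h3 := (x k).2
    have h4 : #C ≤ Fintype.card I := card_le_univ C
    rw [sum_add_distrib, sum_const, smul_eq_mul, mul_one] at hsum
    omega
  have hout : ∀ k ∈ C, ∀ l, l ∉ C → ((x k).1 l : ℕ) < Fintype.card I := by
    intro k hk l hl
    have h1 := hsum' k hk
    have h2 := single_le_sum (f := fun i => ((x k).1 i : ℕ)) (fun _ _ => Nat.zero_le _)
      (mem_sdiff.2 ⟨mem_univ l, hl⟩)
    omega
  refine ⟨C, fun i l => (x i).1 l, hCne, fun i hi => ⟨(x i).2, hxc i hi⟩, ?_, hout⟩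
  intro i hi k hk l
  by_cases hl : l ∈ C
  · have h1 := hsum' i hi
    have h2 := single_le_sum (f := fun l => ((x i).1 l : ℕ) - a l) (fun _ _ => Nat.zero_le _) hl
    have h3 : a l ≤ (x k).1 l := hjmin l k hk
    beta_reduce at h2 ⊢
    omega
  · have := hout i hi l hl
    simp only
    omega

/-- If closed sets `A i`, indexed by the vertices, cover the standard simplex, then some point of
the simplex lies in `A i` for every vertex `i` of its carrier. -/
theorem exists_mem_of_closed_cover {I : Type*} [Fintype I] [Nonempty I] (A : I → Set (I → ℝ))
    (hA : ∀ i, IsClosed (A i)) (hcov : ∀ p ∈ stdSimplex ℝ I, ∃ i, p ∈ A i) :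
    ∃ p ∈ stdSimplex ℝ I, ∀ i, p i ≠ 0 → p ∈ A i := by
  have hsimplex : ∀ (n : ℕ) (v : I → ℕ), ∑ l, v l = n + 1 →
      (fun l => (v l : ℝ) / (n + 1 : ℝ)) ∈ stdSimplex ℝ I := by
    intro n v hv
    refine ⟨fun l => by positivity, ?_⟩
    rw [← sum_div, ← Nat.cast_sum, hv]
    push_cast
    exact div_self (by positivity)
  have hcolor : ∀ (n : ℕ) (v : I → ℕ), ∃ i, ∑ l, v l = n + 1 →
      (fun l => (v l : ℝ) / (n + 1 : ℝ)) ∈ A i := by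
    intro n v
    by_cases hv : ∑ l, v l = n + 1
    · exact (hcov _ (hsimplex n v hv)).imp fun i hi _ => hi
    · exact ⟨Classical.arbitrary I, fun h => absurd h hv⟩
  choose c hc using hcolor
  choose C x hCne hx hclose hsmall using fun n : ℕ => exists_colorful_cluster (n + 1) (c n)
  choose j hj using hCne
  let y : ℕ → I → ℝ := fun n l => (x n (j n) l : ℝ) / (n + 1 : ℝ)
  obtain ⟨p, hp, φ, hφ, hlim⟩ := (isCompact_stdSimplex ℝ I).tendsto_subseq
    (fun n => hsimplex n _ (hx n (j n) (hj n)).1 : ∀ n, y n ∈ stdSimplex ℝ I)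
  refine ⟨p, hp, fun i hi => ?_⟩
  have hsmall0 : Tendsto (fun k => (Fintype.card I : ℝ) / ((φ k : ℝ) + 1)) atTop (𝓝 0) := by
    have := (tendsto_const_div_atTop_nhds_zero_nat (Fintype.card I : ℝ)).comp
      ((tendsto_add_atTop_nat 1).comp hφ.tendsto_atTop)
    refine this.congr fun k => ?_
    simp
  -- Coordinates outside the cluster's color set tend to zero, whereas `p i` is positive.
  have hev : ∀ᶠ k in atTop, i ∈ C (φ k) := by
    have hpi : 0 < p i := lt_of_le_of_ne (hp.1 i) (Ne.symm hi)
    have := hsmall0.eventually_lt ((tendsto_pi_nhds.1 hlim) i) hpi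
    filter_upwards [this] with k hk
    by_contra hiC
    have h1 := hsmall (φ k) (j (φ k)) (hj _) i hiC
    have h2 : (x (φ k) (j (φ k)) i : ℝ) < Fintype.card I := by exact_mod_cast h1
    refine hk.not_ge ?_
    simp only [Function.comp]
    gcongr
  have hlim' : Tendsto (fun k l => (x (φ k) i l : ℝ) / ((φ k : ℝ) + 1)) atTop (𝓝 p) := by
    rw [tendsto_pi_nhds]
    intro l
    have h0 : Tendsto (fun k => (x (φ k) i l : ℝ) / ((φ k : ℝ) + 1) - y (φ k) l) atTop (𝓝 0) := by
      refine squeeze_zero_norm' ?_ hsmall0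
      filter_upwards [hev] with k hk
      have h1 := hclose (φ k) i hk (j (φ k)) (hj _) l
      have h2 := hclose (φ k) (j (φ k)) (hj _) i hk l
      have h1' : (x (φ k) i l : ℝ) ≤ x (φ k) (j (φ k)) l + Fintype.card I := by exact_mod_cast h1.le
      have h2' : (x (φ k) (j (φ k)) l : ℝ) ≤ x (φ k) i l + Fintype.card I := by exact_mod_cast h2.le
      rw [Real.norm_eq_abs, ← sub_div, abs_div, abs_of_pos (by positivity : (0 : ℝ) < φ k + 1)]
      gcongr
      rw [abs_le]
      constructor <;> linarith
    have := h0.add ((tendsto_pi_nhds.1 hlim) l)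
    simpa [y] using this
  refine (hA i).mem_of_tendsto hlim' ?_
  filter_upwards [hev] with k hk
  have h1 := (hx (φ k) i hk)
  have h2 := hc (φ k) _ h1.1
  rwa [h1.2] at h2

end ClosedCover

/-! ### Stationary points of vector fields and of correspondences. -/

section VariationalInequality

open Finset Filter Topology

/-- A continuous vector field on the standard simplex has a stationary point. -/
theorem exists_le_inner_of_continuousOn {I : Type*} [Fintype I] [Nonempty I]
    (f : (I → ℝ) → I → ℝ) (hf : ContinuousOn f (stdSimplex ℝ I)) :
    ∃ p ∈ stdSimplex ℝ I, ∀ l, f p l ≤ ∑ k, p k * f p k := by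
  -- This is Nash's gain function. If the total gain were positive, every coordinate in the support
  -- of `p` would gain strictly over the average, which is impossible.
  let h : I → (I → ℝ) → ℝ := fun l p => max (f p l - ∑ k, p k * f p k) 0
  have hf' : ∀ l, ContinuousOn (fun p => f p l) (stdSimplex ℝ I) := fun l =>
    (continuous_apply l).comp_continuousOn hf
  have hcont : ∀ l, ContinuousOn (h l) (stdSimplex ℝ I) := fun l =>
    ((hf' l).sub (continuousOn_finsetSum _ fun k _ =>
      (continuous_apply k).continuousOn.mul (hf' k))).sup continuousOn_const
  have hclosed : IsClosed (stdSimplex ℝ I) := (isCompact_stdSimplex ℝ I).isClosed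
  obtain ⟨p, hp, hpA⟩ := exists_mem_of_closed_cover
    (fun l => {p ∈ stdSimplex ℝ I | p l * ∑ k, h k p ≤ h l p})
    (fun l => hclosed.isClosed_le ((continuous_apply l).continuousOn.mul
      (continuousOn_finsetSum _ fun k _ => hcont k)) (hcont l))
    (fun p hp => by
      by_contra hcon
      push Not at hcon
      have h1 : ∀ l, h l p < p l * ∑ k, h k p := fun l => by
        by_contra hle
        exact hcon l ⟨hp, not_lt.1 hle⟩
      have h2 : ∑ l, h l p < ∑ l, p l * ∑ k, h k p :=
        sum_lt_sum_of_nonempty univ_nonempty fun l _ => h1 l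
      rw [← sum_mul, hp.2, one_mul] at h2
      exact lt_irrefl _ h2)
  refine ⟨p, hp, ?_⟩
  have hle : ∀ l, p l * ∑ k, h k p ≤ h l p := fun l => by
    by_cases hl : p l = 0
    · rw [hl, zero_mul]
      exact le_max_right _ _
    · exact (hpA l hl).2
  have hS0 : ∑ k, h k p = 0 := by
    by_contra hS
    have hSpos : 0 < ∑ k, h k p :=
      lt_of_le_of_ne (sum_nonneg fun k _ => le_max_right _ _) (Ne.symm hS)
    have h1 : ∀ l, p l * (∑ k, p k * f p k) ≤ p l * f p l := by
      intro l
      rcases (hp.1 l).eq_or_lt with h0 | hpos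
      · rw [← h0, zero_mul, zero_mul]
      · have h2 := (mul_pos hpos hSpos).trans_le (hle l)
        rcases lt_max_iff.1 h2 with h3 | h3
        · exact mul_le_mul_of_nonneg_left (by linarith) hpos.le
        · exact absurd h3 (lt_irrefl _)
    obtain ⟨l, hl⟩ : ∃ l, 0 < p l := by
      by_contra hcon
      push Not at hcon
      have := sum_nonpos fun l (_ : l ∈ univ) => hcon l
      rw [hp.2] at this
      linarith
    have h2 : ∑ l, p l * (∑ k, p k * f p k) < ∑ l, p l * f p l := by
      refine sum_lt_sum (fun l _ => h1 l) ⟨l, mem_univ _, mul_lt_mul_of_pos_left ?_ hl⟩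
      rcases lt_max_iff.1 ((mul_pos hl hSpos).trans_le (hle l)) with h3 | h3
      · linarith
      · exact absurd h3 (lt_irrefl _)
    rw [← sum_mul, hp.2, one_mul] at h2
    exact lt_irrefl _ h2
  intro l
  have := (sum_eq_zero_iff_of_nonneg fun k _ => le_max_right _ _).1 hS0 l (mem_univ l)
  have h1 : f p l - ∑ k, p k * f p k ≤ 0 := (le_max_left _ _).trans this.le
  linarith

/-- A correspondence on the standard simplex with nonempty convex values and compact graph has a
stationary point. -/
theorem exists_le_inner_of_isCompact_graph {I : Type*} [Fintype I] [Nonempty I]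
    (Z : (I → ℝ) → Set (I → ℝ)) (hne : ∀ p ∈ stdSimplex ℝ I, (Z p).Nonempty)
    (hconv : ∀ p ∈ stdSimplex ℝ I, Convex ℝ (Z p))
    (hgraph : IsCompact {x : (I → ℝ) × (I → ℝ) | x.1 ∈ stdSimplex ℝ I ∧ x.2 ∈ Z x.1}) :
    ∃ p ∈ stdSimplex ℝ I, ∃ z ∈ Z p, ∀ l, z l ≤ ∑ k, p k * z k := by
  classical
  have hΔ := isCompact_stdSimplex ℝ I
  obtain ⟨R, hR⟩ := (hgraph.image continuous_snd).isBounded.subset_closedBall 0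
  have happrox : ∀ n : ℕ, ∃ p ∈ stdSimplex ℝ I, ∃ z,
      z ∈ convexHull ℝ (⋃ v ∈ {v | v ∈ stdSimplex ℝ I ∧ dist p v < 1 / ((n : ℝ) + 1)}, Z v) ∧
      ∀ l, z l ≤ ∑ k, p k * z k := by
    intro n
    have hε : (0 : ℝ) < 1 / ((n : ℝ) + 1) := Nat.one_div_pos_of_nat
    set ε := 1 / ((n : ℝ) + 1)
    obtain ⟨t, htΔ, htfin, hcov⟩ := hΔ.finite_cover_balls hε
    lift t to Finset (I → ℝ) using htfin
    choose! ζ hζ using hne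
    let w : (I → ℝ) → (I → ℝ) → ℝ := fun p v => max (ε - dist p v) 0
    have hw0 : ∀ p v, 0 ≤ w p v := fun p v => le_max_right _ _
    have hwpos : ∀ p ∈ stdSimplex ℝ I, 0 < ∑ v ∈ t, w p v := by
      intro p hp
      obtain ⟨v, hv, hpv⟩ := Set.mem_iUnion₂.1 (hcov hp)
      refine sum_pos' (fun v _ => hw0 p v) ⟨v, hv, lt_max_of_lt_left ?_⟩
      rw [Metric.mem_ball] at hpv
      linarith
    have hwc : ∀ v, Continuous fun p => w p v := fun v => by fun_prop
    -- A continuous approximate selection: chosen values at the net points are averaged, with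
    -- positive weights only within distance `ε` of `p`.
    obtain ⟨p, hp, hvi⟩ := exists_le_inner_of_continuousOn (fun p => t.centerMass (w p) ζ) (by
      refine ContinuousOn.smul (ContinuousOn.inv₀ ?_ fun p hp => (hwpos p hp).ne') ?_
      · exact (continuous_finsetSum _ fun v _ => hwc v).continuousOn
      · exact (continuous_finsetSum _ fun v _ => (hwc v).smul continuous_const).continuousOn)
    refine ⟨p, hp, _, ?_, hvi⟩
    rw [← centerMass_filter_ne_zero]
    refine centerMass_mem_convexHull _ (fun v _ => hw0 p v) ?_ fun v hv => ?_
    · rw [sum_filter_ne_zero]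
      exact hwpos p hp
    · obtain ⟨hvt, hvw⟩ := mem_filter.1 hv
      refine Set.mem_iUnion₂.2 ⟨v, ⟨htΔ hvt, ?_⟩, hζ v (htΔ hvt)⟩
      by_contra hle
      exact hvw (max_eq_right (by linarith))
  choose p hp z hz hvi using happrox
  have hzR : ∀ n, z n ∈ Metric.closedBall (0 : I → ℝ) R := fun n => by
    refine convexHull_min ?_ (convex_closedBall 0 R) (hz n)
    refine Set.iUnion₂_subset fun v hv a ha => hR ⟨(v, a), ⟨hv.1, ha⟩, rfl⟩
  obtain ⟨⟨p', z'⟩, ⟨hp', -⟩, φ, hφ, hlim⟩ := (hΔ.prod (isCompact_closedBall 0 R)).tendsto_subseq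
    (fun n => ⟨hp n, hzR n⟩ : ∀ n, (p n, z n) ∈ stdSimplex ℝ I ×ˢ Metric.closedBall 0 R)
  have hlimp : Tendsto (fun k => p (φ k)) atTop (𝓝 p') := (continuous_fst.tendsto _).comp hlim
  have hlimz : Tendsto (fun k => z (φ k)) atTop (𝓝 z') := (continuous_snd.tendsto _).comp hlim
  refine ⟨p', hp', z', ?_, fun l => ?_⟩
  swap
  · refine le_of_tendsto_of_tendsto ((tendsto_pi_nhds.1 hlimz) l)
      (tendsto_finsetSum _ fun k _ => ((tendsto_pi_nhds.1 hlimp) k).mul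
        ((tendsto_pi_nhds.1 hlimz) k)) (Eventually.of_forall fun k => hvi (φ k) l)
  by_contra hz'
  have hclosed : IsClosed (Z p') := by
    have h1 : Z p' = (fun a => (p', a)) ⁻¹'
        {x : (I → ℝ) × (I → ℝ) | x.1 ∈ stdSimplex ℝ I ∧ x.2 ∈ Z x.1} := by
      ext a
      simp [hp']
    rw [h1]
    exact hgraph.isClosed.preimage (by fun_prop)
  -- By compactness of the graph, the open half-space `g < u` contains `Z v` for all `v` near `p'`,
  -- hence also the hulls from which the `z n` come; their limit cannot satisfy `u < g z'`.
  obtain ⟨g, u, hg, hu⟩ := geometric_hahn_banach_closed_point (hconv p' hp') hclosed hz'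
  have hbad : IsClosed (Prod.fst '' ({x : (I → ℝ) × (I → ℝ) | x.1 ∈ stdSimplex ℝ I ∧ x.2 ∈ Z x.1} ∩
      {x | u ≤ g x.2})) :=
    ((hgraph.inter_right (isClosed_le continuous_const (by fun_prop))).image
      continuous_fst).isClosed
  have hnotin : p' ∉ Prod.fst '' ({x : (I → ℝ) × (I → ℝ) | x.1 ∈ stdSimplex ℝ I ∧ x.2 ∈ Z x.1} ∩
      {x | u ≤ g x.2}) := by
    rintro ⟨⟨v, a⟩, ⟨⟨-, ha⟩, hua⟩, rfl⟩
    exact (hg a ha).not_ge hua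
  obtain ⟨δ, hδ, hball⟩ := Metric.isOpen_iff.1 hbad.isOpen_compl p' hnotin
  have hev : ∀ᶠ k in atTop, g (z (φ k)) < u := by
    have h1 : ∀ᶠ k in atTop, dist (p (φ k)) p' < δ / 2 :=
      hlimp.eventually (Metric.ball_mem_nhds p' (half_pos hδ))
    have h2 : ∀ᶠ k in atTop, 1 / ((φ k : ℝ) + 1) < δ / 2 :=
      (tendsto_one_div_add_atTop_nhds_zero_nat.comp hφ.tendsto_atTop).eventually
        (gt_mem_nhds (half_pos hδ))
    filter_upwards [h1, h2] with k hk1 hk2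
    have hhalf : Convex ℝ {a | g a < u} := convex_halfSpace_lt g.isLinear u
    refine convexHull_min ?_ hhalf (hz (φ k))
    refine Set.iUnion₂_subset fun v hv a ha => ?_
    by_contra hle
    have hle' : u ≤ g a := not_lt.1 hle
    refine hball (?_ : v ∈ Metric.ball p' δ) ⟨(v, a), ⟨⟨hv.1, ha⟩, hle'⟩, rfl⟩
    rw [Metric.mem_ball]
    have h3 := dist_triangle v (p (φ k)) p'
    have h4 := hv.2
    rw [dist_comm] at h4
    linarith
  have := le_of_tendsto ((g.continuous.tendsto z').comp hlimz) (hev.mono fun k hk => hk.le)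
  linarith

end VariationalInequality

namespace AllocationProblem

open Finset Filter Topology Matrix

/-! ### Consumption spaces and local nonsatiation. -/

section Consumption

variable {I O : Type*} [Fintype I] [Fintype O] (Γ : AllocationProblem I O)

theorem zero_mem_C (i : I) : (0 : O → ℝ) ∈ Γ.C i := ⟨le_rfl, by simpa using (Γ.c_pos i).le⟩

theorem convex_C (i : I) : Convex ℝ (Γ.C i) := by
  intro x hx y hy a b ha hb hab
  refine ⟨fun l => ?_, ?_⟩
  · have h1 := hx.1 l
    have h2 := hy.1 l
    simp only [Pi.zero_apply, Pi.add_apply, Pi.smul_apply, smul_eq_mul] at *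
    positivity
  · simp only [Pi.add_apply, Pi.smul_apply, smul_eq_mul, sum_add_distrib, ← mul_sum]
    calc a * ∑ l, x l + b * ∑ l, y l ≤ a * Γ.c i + b * Γ.c i := by
          gcongr
          · exact hx.2
          · exact hy.2
      _ = Γ.c i := by rw [← add_mul, hab, one_mul]

theorem isCompact_C (i : I) : IsCompact (Γ.C i) := by
  refine (isCompact_Icc (a := (0 : O → ℝ)) (b := fun _ => Γ.c i)).of_isClosed_subset ?_ ?_
  · exact (isClosed_le continuous_const continuous_id).inter
      (isClosed_le (f := fun x : O → ℝ => ∑ l, x l) (by fun_prop) continuous_const)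
  · intro x hx
    exact ⟨hx.1, fun l => (single_le_sum (fun k _ => hx.1 k) (mem_univ l)).trans hx.2⟩

theorem smul_mem_C {i : I} {x : O → ℝ} (hx : x ∈ Γ.C i) {t : ℝ} (h0 : 0 ≤ t) (h1 : t ≤ 1) :
    t • x ∈ Γ.C i := by
  simpa using Γ.convex_C i hx (Γ.zero_mem_C i) h0 (sub_nonneg.2 h1) (by ring)

theorem continuousOn_u (i : I) : ContinuousOn (Γ.u i) (Γ.C i) := Γ.continuous_u i

theorem tendsto_u_smul {i : I} {x : O → ℝ} (hx : x ∈ Γ.C i) :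
    Tendsto (fun t : ℝ => Γ.u i (t • x)) (𝓝[<] 1) (𝓝 (Γ.u i x)) := by
  have h1 : Tendsto (fun t : ℝ => t • x) (𝓝[<] 1) (𝓝[Γ.C i] x) := by
    refine tendsto_nhdsWithin_iff.2 ⟨?_, ?_⟩
    · have : Tendsto (fun t : ℝ => t • x) (𝓝 1) (𝓝 ((1 : ℝ) • x)) :=
        (continuous_id.smul continuous_const).tendsto 1
      rw [one_smul] at this
      exact this.mono_left nhdsWithin_le_nhds
    · filter_upwards [Ioo_mem_nhdsLT (zero_lt_one' ℝ)] with t ht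
      exact Γ.smul_mem_C hx ht.1.le ht.2.le
  exact (Γ.continuousOn_u i x hx).tendsto.comp h1

/-- Shrinking `x` and mixing `y` with a small positive constant bundle makes every coordinate
inequality strict without leaving the consumption space; then continuity applies. -/
theorem u_le_of_le {i : I} {x y : O → ℝ} (hx : 0 ≤ x) (hy : y ∈ Γ.C i) (hxy : x ≤ y) :
    Γ.u i x ≤ Γ.u i y := by
  have hxC : x ∈ Γ.C i := ⟨hx, (sum_le_sum fun l _ => hxy l).trans hy.2⟩
  set k : ℝ := Γ.c i / (Fintype.card O + 1) with hk
  have hkpos : 0 < k := div_pos (Γ.c_pos i) (by positivity)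
  have hkc : Fintype.card O * k ≤ Γ.c i := by
    rw [hk, mul_div_assoc', div_le_iff₀ (by positivity)]
    nlinarith [(Γ.c_pos i).le]
  let z : ℝ → O → ℝ := fun t => t • y + (1 - t) • fun _ => k
  have hkC : (fun _ => k : O → ℝ) ∈ Γ.C i := ⟨fun _ => hkpos.le, by simpa using hkc⟩
  have hz : Tendsto (fun t => Γ.u i (z t)) (𝓝[<] 1) (𝓝 (Γ.u i y)) := by
    have h1 : Tendsto z (𝓝[<] 1) (𝓝[Γ.C i] y) := by
      refine tendsto_nhdsWithin_iff.2 ⟨?_, ?_⟩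
      · have hc : Continuous z := by fun_prop
        have := hc.tendsto 1
        simp only [z, one_smul, sub_self, zero_smul, add_zero] at this
        exact this.mono_left nhdsWithin_le_nhds
      · filter_upwards [Ioo_mem_nhdsLT (zero_lt_one' ℝ)] with t ht
        exact Γ.convex_C i hy hkC ht.1.le (sub_nonneg.2 ht.2.le) (by ring)
    exact (Γ.continuousOn_u i y hy).tendsto.comp h1
  refine le_of_tendsto_of_tendsto (Γ.tendsto_u_smul hxC) hz ?_
  filter_upwards [Ioo_mem_nhdsLT (zero_lt_one' ℝ)] with t ht
  refine (Γ.monotone_u i _ _ ?_ ?_ fun l => ?_).le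
  · exact smul_nonneg ht.1.le hx
  · exact (Γ.convex_C i hy hkC ht.1.le (sub_nonneg.2 ht.2.le) (by ring)).2
  · simp only [z, Pi.add_apply, Pi.smul_apply, smul_eq_mul]
    have h1 := mul_le_mul_of_nonneg_left (hxy l) ht.1.le
    have h2 := mul_pos (sub_pos.2 ht.2) hkpos
    linarith

/-- Any bundle that leaves some of the overall demand unused can be improved at small cost. -/
theorem exists_better_of_sum_lt {i : I} {x : O → ℝ} (hx : x ∈ Γ.C i) (hlt : ∑ l, x l < Γ.c i)
    {p : O → ℝ} {w : ℝ} (hw : p ⬝ᵥ x < w) : ∃ y ∈ Γ.C i, p ⬝ᵥ y < w ∧ Γ.u i x < Γ.u i y := by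
  let y : ℝ → O → ℝ := fun t l => x l + t
  have h0 : y 0 = x := by simp [y]
  have h1 : ∀ᶠ t in 𝓝[>] (0 : ℝ), p ⬝ᵥ y t < w := by
    have hc : Continuous fun t => p ⬝ᵥ y t := by unfold dotProduct; fun_prop
    have h2 := (hc.tendsto 0).mono_left (nhdsWithin_le_nhds (s := Set.Ioi 0))
    rw [h0] at h2
    exact h2.eventually (gt_mem_nhds hw)
  have h2 : ∀ᶠ t in 𝓝[>] (0 : ℝ), ∑ l, y t l < Γ.c i := by
    have hc : Continuous fun t => ∑ l, y t l := by fun_prop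
    have h3 := (hc.tendsto 0).mono_left (nhdsWithin_le_nhds (s := Set.Ioi 0))
    rw [h0] at h3
    exact h3.eventually (gt_mem_nhds hlt)
  obtain ⟨t, ht1, ht2, ht3⟩ := (h1.and (h2.and self_mem_nhdsWithin)).exists
  have ht : 0 < t := ht3
  refine ⟨y t, ⟨fun l => add_nonneg (hx.1 l) ht.le, ht2.le⟩, ht1, ?_⟩
  exact Γ.monotone_u i _ _ hx.1 ht2.le fun l => lt_add_of_pos_right _ ht

/-- Local nonsatiation: any bundle that is not optimal can be improved at small cost. -/
theorem exists_better {i : I} (hq : QuasiconcaveOn ℝ (Γ.C i) (Γ.u i)) {x b : O → ℝ}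
    (hx : x ∈ Γ.C i) (hb : b ∈ Γ.C i) (hxb : Γ.u i x < Γ.u i b) {p : O → ℝ} {w : ℝ}
    (hw : p ⬝ᵥ x < w) : ∃ y ∈ Γ.C i, p ⬝ᵥ y < w ∧ Γ.u i x < Γ.u i y := by
  -- When `x` exhausts the overall demand, no coordinatewise increase is possible. Mixing in a
  -- little of a shrunken better bundle frees some demand and, by quasi-concavity, does not lower
  -- utility.
  obtain ⟨t, ht, htu⟩ := (Eventually.and (Ioo_mem_nhdsLT (zero_lt_one' ℝ))
    ((Γ.tendsto_u_smul hb).eventually (lt_mem_nhds hxb))).exists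
  have hb' := Γ.smul_mem_C hb ht.1.le ht.2.le
  have hsum : ∑ l, (t • b) l < Γ.c i := by
    simp only [Pi.smul_apply, smul_eq_mul, ← mul_sum]
    calc t * ∑ l, b l ≤ t * Γ.c i := mul_le_mul_of_nonneg_left hb.2 ht.1.le
      _ < Γ.c i := by nlinarith [Γ.c_pos i, ht.2]
  set b' := t • b
  let y : ℝ → O → ℝ := fun a => a • x + (1 - a) • b'
  have h1 : ∀ᶠ a in 𝓝[<] (1 : ℝ), p ⬝ᵥ y a < w := by
    have hc : Continuous fun a => p ⬝ᵥ y a := by unfold dotProduct; fun_prop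
    have h2 := (hc.tendsto 1).mono_left (nhdsWithin_le_nhds (s := Set.Iio 1))
    simp only [y, one_smul, sub_self, zero_smul, add_zero] at h2
    exact h2.eventually (gt_mem_nhds hw)
  obtain ⟨a, ha1, ha2⟩ := (h1.and (Ioo_mem_nhdsLT (zero_lt_one' ℝ))).exists
  have hyC : y a ∈ Γ.C i := Γ.convex_C i hx hb' ha2.1.le (sub_nonneg.2 ha2.2.le) (by ring)
  have hyu : Γ.u i x ≤ Γ.u i (y a) :=
    (hq (Γ.u i x) ⟨hx, le_rfl⟩ ⟨hb', htu.le⟩ ha2.1.le (sub_nonneg.2 ha2.2.le) (by ring)).2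
  have hysum : ∑ l, y a l < Γ.c i := by
    simp only [y, Pi.add_apply, Pi.smul_apply, smul_eq_mul, sum_add_distrib, ← mul_sum]
    have h3 := mul_le_mul_of_nonneg_left hx.2 ha2.1.le
    have h4 := mul_lt_mul_of_pos_left hsum (sub_pos.2 ha2.2)
    linarith
  obtain ⟨z, hz, hpz, huz⟩ := Γ.exists_better_of_sum_lt hyC hysum ha1
  exact ⟨z, hz, hpz, hyu.trans_lt huz⟩

/-- If bundles do not exhaust the supply, the rest can be distributed among the agents. -/
theorem exists_allocation_ge {x : I → O → ℝ} (hx : ∀ i, x i ∈ Γ.C i)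
    (hq : ∀ l, ∑ i, x i l ≤ Γ.q l) :
    ∃ y, Γ.IsAllocation y ∧ (∀ i, x i ≤ y i) ∧
      ∀ i l, y i l ≤ x i l + (Γ.q l - ∑ j, x j l) := by
  -- The remaining supply `d` is shared in proportion to unused demand `a`. If all `a i` vanish, so
  -- does `d`, and the shares `0 / 0 = 0` do no harm.
  let a : I → ℝ := fun i => Γ.c i - ∑ l, x i l
  let d : O → ℝ := fun l => Γ.q l - ∑ i, x i l
  have ha : ∀ i, 0 ≤ a i := fun i => sub_nonneg.2 (hx i).2
  have hd : ∀ l, 0 ≤ d l := fun l => sub_nonneg.2 (hq l)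
  have hA : 0 ≤ ∑ i, a i := sum_nonneg fun i _ => ha i
  have hda : ∑ l, d l ≤ ∑ i, a i := by
    simp only [a, d, sum_sub_distrib]
    rw [sum_comm]
    linarith [Γ.no_excess_supply]
  have hshare : ∀ i, 0 ≤ a i / ∑ j, a j := fun i => div_nonneg (ha i) hA
  have hshare1 : ∀ i, a i / ∑ j, a j ≤ 1 := fun i =>
    div_le_one_of_le₀ (single_le_sum (fun j _ => ha j) (mem_univ i)) hA
  refine ⟨fun i l => x i l + a i / (∑ j, a j) * d l, ⟨fun i => ⟨fun l => ?_, ?_⟩, fun l => ?_⟩,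
    fun i l => ?_, fun i l => ?_⟩
  · exact add_nonneg ((hx i).1 l) (mul_nonneg (hshare i) (hd l))
  · rw [sum_add_distrib, ← mul_sum]
    have h1 : a i / (∑ j, a j) * ∑ l, d l ≤ a i := by
      calc a i / (∑ j, a j) * ∑ l, d l ≤ a i / (∑ j, a j) * ∑ j, a j :=
            mul_le_mul_of_nonneg_left hda (hshare i)
        _ ≤ a i := by
            rw [div_mul_eq_mul_div]
            exact div_le_of_le_mul₀ hA (ha i) le_rfl
    simp only [a] at h1 ⊢
    linarith
  · rw [sum_add_distrib, ← sum_mul, ← sum_div]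
    by_cases h0 : ∑ j, a j = 0
    · have h1 : d l = 0 := by
        have h2 : ∑ l, d l = 0 := le_antisymm (h0 ▸ hda) (sum_nonneg fun l _ => hd l)
        exact (sum_eq_zero_iff_of_nonneg fun l _ => hd l).1 h2 l (mem_univ l)
      rw [h1, mul_zero, add_zero]
      simp only [d] at h1
      linarith
    · rw [div_self h0, one_mul]
      simp only [d]
      ring
  · exact le_add_of_nonneg_right (mul_nonneg (hshare i) (hd l))
  · exact add_le_add le_rfl (mul_le_of_le_one_left (hd l) (hshare1 i))

end Consumption

end AllocationProblem

namespace AllocationProblem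

open Finset Filter Topology Matrix

/-! ### Incomes, spending and balanced basic incomes. -/

section Expenditure

variable {I O : Type*} [Fintype I] [Fintype O] (Γ : AllocationProblem I O)

/-- The bundles that agent `i` accepts. -/
def acceptable (i : I) : Set (O → ℝ) := {z ∈ Γ.C i | Γ.r i ≤ Γ.u i z}

/-- The bundles that satiate agent `i`. -/
def bliss (i : I) : Set (O → ℝ) := {z ∈ Γ.C i | ∀ y ∈ Γ.C i, Γ.u i y ≤ Γ.u i z}

/-- The least cost of an acceptable bundle. -/
noncomputable def reservationCost (i : I) (p : O → ℝ) : ℝ :=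
  sInf ((fun z => p ⬝ᵥ z) '' Γ.acceptable i)

/-- The least cost of a satiating bundle. -/
noncomputable def blissCost (i : I) (p : O → ℝ) : ℝ := sInf ((fun z => p ⬝ᵥ z) '' Γ.bliss i)

/-- The income of an agent when `M` is the common basic income: it is raised as far as is
necessary to afford an acceptable bundle. -/
noncomputable def income (p : O → ℝ) (M : ℝ) (i : I) : ℝ := max M (Γ.reservationCost i p)

/-- The part of the income that an agent spends if she does not spend more than she must to be
satiated. -/
noncomputable def spending (p : O → ℝ) (M : ℝ) (i : I) : ℝ :=
  min (Γ.income p M i) (Γ.blissCost i p)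

/-- A basic income at which every agent can afford a satiating bundle. -/
noncomputable def maxIncome : ℝ := 1 + ∑ i, Γ.c i

/-- A basic income is balanced at prices `p` if the total spending is the value of the supply, or
if the basic income suffices to satiate everybody and the total spending is smaller. -/
def IsBalanced (p : O → ℝ) (M : ℝ) : Prop :=
  M ∈ Set.Icc 0 Γ.maxIncome ∧ ∑ i, Γ.spending p M i ≤ p ⬝ᵥ Γ.q ∧
    (∑ i, Γ.spending p M i = p ⬝ᵥ Γ.q ∨ M = Γ.maxIncome)

theorem dotProduct_nonneg_of_mem {i : I} {p z : O → ℝ} (hp : p ∈ stdSimplex ℝ O)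
    (hz : z ∈ Γ.C i) : 0 ≤ p ⬝ᵥ z :=
  sum_nonneg fun l _ => mul_nonneg (hp.1 l) (hz.1 l)

theorem isClosed_upper (i : I) (a : ℝ) : IsClosed {z ∈ Γ.C i | a ≤ Γ.u i z} :=
  (Γ.isCompact_C i).isClosed.isClosed_le continuousOn_const (Γ.continuousOn_u i)

theorem isCompact_acceptable (i : I) : IsCompact (Γ.acceptable i) :=
  (Γ.isCompact_C i).of_isClosed_subset (Γ.isClosed_upper i _) fun _ hz => hz.1

theorem nonempty_bliss (i : I) : (Γ.bliss i).Nonempty := by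
  obtain ⟨b, hb, hmax⟩ := (Γ.isCompact_C i).exists_isMaxOn ⟨0, Γ.zero_mem_C i⟩ (Γ.continuousOn_u i)
  exact ⟨b, hb, fun y hy => hmax hy⟩

theorem isCompact_bliss (i : I) : IsCompact (Γ.bliss i) := by
  obtain ⟨b, hb⟩ := Γ.nonempty_bliss i
  have : Γ.bliss i = {z ∈ Γ.C i | Γ.u i b ≤ Γ.u i z} := by
    ext z
    exact ⟨fun hz => ⟨hz.1, hz.2 b hb.1⟩, fun hz => ⟨hz.1, fun y hy => (hb.2 y hy).trans hz.2⟩⟩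
  rw [this]
  exact (Γ.isCompact_C i).of_isClosed_subset (Γ.isClosed_upper i _) fun _ hz => hz.1

theorem continuous_dotProduct_uncurry :
    Continuous fun x : (O → ℝ) × (O → ℝ) => x.1 ⬝ᵥ x.2 := by
  unfold dotProduct
  fun_prop

theorem continuous_reservationCost (i : I) : Continuous (Γ.reservationCost i) :=
  (Γ.isCompact_acceptable i).continuous_sInf continuous_dotProduct_uncurry

theorem continuous_blissCost (i : I) : Continuous (Γ.blissCost i) :=
  (Γ.isCompact_bliss i).continuous_sInf continuous_dotProduct_uncurry

theorem continuous_income (i : I) : Continuous fun x : (O → ℝ) × ℝ => Γ.income x.1 x.2 i :=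
  continuous_snd.max ((Γ.continuous_reservationCost i).comp continuous_fst)

theorem continuous_spending (i : I) : Continuous fun x : (O → ℝ) × ℝ => Γ.spending x.1 x.2 i :=
  (Γ.continuous_income i).min ((Γ.continuous_blissCost i).comp continuous_fst)

theorem exists_min_cost (p : O → ℝ) {S : Set (O → ℝ)} (hS : IsCompact S) (hne : S.Nonempty) :
    ∃ z ∈ S, p ⬝ᵥ z = sInf ((fun z => p ⬝ᵥ z) '' S) ∧ ∀ y ∈ S, p ⬝ᵥ z ≤ p ⬝ᵥ y := by
  obtain ⟨z, hz, hp, hmin⟩ := hS.exists_sInf_image_eq_and_le hne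
    (continuous_dotProduct_uncurry.comp (Continuous.prodMk_right p)).continuousOn
  exact ⟨z, hz, hp.symm, hmin⟩

theorem exists_acceptable_cost {i : I} (h : (Γ.acceptable i).Nonempty) (p : O → ℝ) :
    ∃ z ∈ Γ.acceptable i, p ⬝ᵥ z = Γ.reservationCost i p :=
  let ⟨z, hz, h1, _⟩ := exists_min_cost p (Γ.isCompact_acceptable i) h
  ⟨z, hz, h1⟩

theorem reservationCost_le {i : I} (p : O → ℝ) {z : O → ℝ} (hz : z ∈ Γ.acceptable i) :
    Γ.reservationCost i p ≤ p ⬝ᵥ z := by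
  obtain ⟨y, -, h1, h2⟩ := exists_min_cost p (Γ.isCompact_acceptable i) ⟨z, hz⟩
  exact h1.symm.trans_le (h2 z hz)

theorem exists_bliss_cost (i : I) (p : O → ℝ) : ∃ z ∈ Γ.bliss i, p ⬝ᵥ z = Γ.blissCost i p :=
  let ⟨z, hz, h1, _⟩ := exists_min_cost p (Γ.isCompact_bliss i) (Γ.nonempty_bliss i)
  ⟨z, hz, h1⟩

theorem blissCost_le {i : I} (p : O → ℝ) {z : O → ℝ} (hz : z ∈ Γ.bliss i) :
    Γ.blissCost i p ≤ p ⬝ᵥ z := by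
  obtain ⟨y, -, h1, h2⟩ := exists_min_cost p (Γ.isCompact_bliss i) ⟨z, hz⟩
  exact h1.symm.trans_le (h2 z hz)

theorem blissCost_nonneg {i : I} {p : O → ℝ} (hp : p ∈ stdSimplex ℝ O) : 0 ≤ Γ.blissCost i p := by
  obtain ⟨z, hz, h⟩ := Γ.exists_bliss_cost i p
  exact h ▸ Γ.dotProduct_nonneg_of_mem hp hz.1

theorem blissCost_lt_maxIncome {i : I} {p : O → ℝ} (hp : p ∈ stdSimplex ℝ O) :
    Γ.blissCost i p < Γ.maxIncome := by
  obtain ⟨z, hz, h⟩ := Γ.exists_bliss_cost i p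
  have h1 : p ⬝ᵥ z ≤ ∑ l, z l := by
    refine sum_le_sum fun l _ => mul_le_of_le_one_left (hz.1.1 l) ?_
    rw [← hp.2]
    exact single_le_sum (fun k _ => hp.1 k) (mem_univ l)
  have h2 : Γ.c i ≤ ∑ i, Γ.c i := single_le_sum (fun k _ => (Γ.c_pos k).le) (mem_univ i)
  have h3 := hz.1.2
  simp only [maxIncome]
  linarith

theorem maxIncome_pos : 0 < Γ.maxIncome :=
  add_pos_of_pos_of_nonneg one_pos (sum_nonneg fun i _ => (Γ.c_pos i).le)

theorem income_mono (p : O → ℝ) {M M' : ℝ} (h : M ≤ M') (i : I) :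
    Γ.income p M i ≤ Γ.income p M' i := max_le_max_right _ h

theorem spending_mono (p : O → ℝ) {M M' : ℝ} (h : M ≤ M') (i : I) :
    Γ.spending p M i ≤ Γ.spending p M' i := min_le_min_right _ (Γ.income_mono p h i)

theorem spending_nonneg {p : O → ℝ} (hp : p ∈ stdSimplex ℝ O) {M : ℝ} (hM : 0 ≤ M) (i : I) :
    0 ≤ Γ.spending p M i := le_min (le_max_of_le_left hM) (Γ.blissCost_nonneg hp)

/-- At zero basic income nobody spends more than the reservation cost, so the intermediate value
theorem applies unless even `maxIncome` leads to too little spending. -/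
theorem exists_isBalanced (hne : ∀ i, (Γ.acceptable i).Nonempty) {p : O → ℝ}
    (hp : p ∈ stdSimplex ℝ O) (hle : ∑ i, Γ.reservationCost i p ≤ p ⬝ᵥ Γ.q) :
    ∃ M, Γ.IsBalanced p M := by
  by_cases hT : ∑ i, Γ.spending p Γ.maxIncome i ≤ p ⬝ᵥ Γ.q
  · exact ⟨Γ.maxIncome, ⟨Γ.maxIncome_pos.le, le_rfl⟩, hT, Or.inr rfl⟩
  · have h0 : ∑ i, Γ.spending p 0 i ≤ p ⬝ᵥ Γ.q := by
      refine le_trans (sum_le_sum fun i _ => ?_) hle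
      refine (min_le_left _ _).trans (max_le ?_ le_rfl)
      obtain ⟨z, hz, h⟩ := Γ.exists_acceptable_cost (hne i) p
      exact h ▸ Γ.dotProduct_nonneg_of_mem hp hz.1
    have hc : Continuous fun M => ∑ i, Γ.spending p M i :=
      continuous_finsetSum _ fun i _ => (Γ.continuous_spending i).comp (Continuous.prodMk_right p)
    obtain ⟨M, hM, hMq⟩ := intermediate_value_Icc Γ.maxIncome_pos.le hc.continuousOn
      ⟨h0, (not_le.1 hT).le⟩
    exact ⟨M, hM, hMq.le, Or.inl hMq⟩

/-- Each agent's spending is monotone in `M`, so equal totals force equal summands. -/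
theorem IsBalanced.spending_eq_of_le {p : O → ℝ} {M M' : ℝ} (h : Γ.IsBalanced p M)
    (h' : Γ.IsBalanced p M') (hle : M ≤ M') : Γ.spending p M = Γ.spending p M' := by
  rcases h.2.2 with heq | heq
  · have h1 : ∑ i, Γ.spending p M i = ∑ i, Γ.spending p M' i :=
      le_antisymm (sum_le_sum fun i _ => Γ.spending_mono p hle i) (heq ▸ h'.2.1)
    funext i
    exact (sum_eq_sum_iff_of_le fun i _ => Γ.spending_mono p hle i).1 h1 i (mem_univ i)
  · rw [le_antisymm hle (heq ▸ h'.1.2)]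

theorem IsBalanced.spending_eq {p : O → ℝ} {M M' : ℝ} (h : Γ.IsBalanced p M)
    (h' : Γ.IsBalanced p M') : Γ.spending p M = Γ.spending p M' := by
  rcases le_total M M' with hle | hle
  · exact h.spending_eq_of_le Γ h' hle
  · exact (h'.spending_eq_of_le Γ h hle).symm

theorem isClosed_isBalanced : IsClosed {x : (O → ℝ) × ℝ | Γ.IsBalanced x.1 x.2} := by
  have h1 : Continuous fun x : (O → ℝ) × ℝ => ∑ i, Γ.spending x.1 x.2 i :=
    continuous_finsetSum _ fun i _ => Γ.continuous_spending i
  have h2 : Continuous fun x : (O → ℝ) × ℝ => x.1 ⬝ᵥ Γ.q :=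
    continuous_dotProduct_uncurry.comp (continuous_fst.prodMk continuous_const)
  exact (isClosed_Icc.preimage continuous_snd).inter ((isClosed_le h1 h2).inter
    ((isClosed_eq h1 h2).union (isClosed_eq continuous_snd continuous_const)))

/-- The spending of the agents at a balanced basic income is a continuous function of prices. -/
theorem continuous_spending_of_isBalanced {M : stdSimplex ℝ O → ℝ}
    (hM : ∀ p, Γ.IsBalanced p.1 (M p)) : Continuous fun p => Γ.spending p.1 (M p) := by
  rw [continuous_iff_seqContinuous]
  intro p p' hp
  -- The selected `M` may jump, but each cluster point of it is balanced, and all balanced basic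
  -- incomes give the same spending.
  refine tendsto_of_subseq_tendsto fun ns hns => ?_
  obtain ⟨M', -, φ, hφ, hlim⟩ := (isCompact_Icc (a := (0 : ℝ)) (b := Γ.maxIncome)).tendsto_subseq
    (fun n => (hM (p (ns n))).1)
  refine ⟨φ, ?_⟩
  have hlimp : Tendsto (fun k => (p (ns (φ k))).1) atTop (𝓝 p'.1) :=
    (continuous_subtype_val.tendsto _).comp (hp.comp (hns.comp hφ.tendsto_atTop))
  have hlim' : Tendsto (fun k => ((p (ns (φ k))).1, M (p (ns (φ k))))) atTop (𝓝 (p'.1, M')) :=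
    hlimp.prodMk_nhds hlim
  have hbal : Γ.IsBalanced p'.1 M' := Γ.isClosed_isBalanced.mem_of_tendsto hlim'
    (Eventually.of_forall fun k => hM (p (ns (φ k))))
  beta_reduce
  rw [(hM p').spending_eq Γ hbal, tendsto_pi_nhds]
  intro i
  exact ((Γ.continuous_spending i).tendsto _).comp hlim'

end Expenditure

/-! ### Existence of a quasi-equilibrium. -/

section QuasiEquilibrium

variable {I O : Type*} [Fintype I] [Fintype O] (Γ : AllocationProblem I O)

/-- Every agent spends at most the required amount, and no bundle that costs less than her income
is better than the bundle that she gets. -/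
def quasiDemand (p : O → ℝ) (M : ℝ) : Set (I → O → ℝ) :=
  {x | ∀ i, x i ∈ Γ.C i ∧ p ⬝ᵥ x i ≤ Γ.spending p M i ∧
    ∀ y ∈ Γ.C i, p ⬝ᵥ y < Γ.income p M i → Γ.u i y ≤ Γ.u i (x i)}

theorem nonempty_quasiDemand (p : O → ℝ) {M : ℝ} (hM : 0 ≤ M) :
    (Γ.quasiDemand p M).Nonempty := by
  have : ∀ i, ∃ z ∈ Γ.C i, p ⬝ᵥ z ≤ Γ.spending p M i ∧
      ∀ y ∈ Γ.C i, p ⬝ᵥ y < Γ.income p M i → Γ.u i y ≤ Γ.u i z := by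
    intro i
    rcases le_total (Γ.blissCost i p) (Γ.income p M i) with h | h
    · obtain ⟨b, hb, hbp⟩ := Γ.exists_bliss_cost i p
      exact ⟨b, hb.1, by rw [hbp, spending, min_eq_right h], fun y hy _ => hb.2 y hy⟩
    · have hcl : IsClosed {z : O → ℝ | p ⬝ᵥ z ≤ Γ.income p M i} :=
        isClosed_le (continuous_dotProduct_uncurry.comp (Continuous.prodMk_right p))
          continuous_const
      obtain ⟨z, hz, hmax⟩ := ((Γ.isCompact_C i).inter_right hcl).exists_isMaxOn
        ⟨0, Γ.zero_mem_C i, by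
          simp only [Set.mem_ofPred_eq, dotProduct_zero]
          exact le_max_of_le_left hM⟩
        ((Γ.continuousOn_u i).mono Set.inter_subset_left)
      exact ⟨z, hz.1, by rw [spending, min_eq_left h]; exact hz.2,
        fun y hy hyw => hmax ⟨hy, hyw.le⟩⟩
  choose x hx using this
  exact ⟨x, hx⟩

theorem convex_quasiDemand (hq : ∀ i, QuasiconcaveOn ℝ (Γ.C i) (Γ.u i)) (p : O → ℝ) (M : ℝ) :
    Convex ℝ (Γ.quasiDemand p M) := by
  intro x hx y hy a b ha hb hab i
  refine ⟨Γ.convex_C i (hx i).1 (hy i).1 ha hb hab, ?_, fun z hz hzw => ?_⟩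
  · have h1 := mul_le_mul_of_nonneg_left (hx i).2.1 ha
    have h2 := mul_le_mul_of_nonneg_left (hy i).2.1 hb
    simp only [Pi.add_apply, Pi.smul_apply, dotProduct_add, dotProduct_smul, smul_eq_mul]
    calc _ ≤ a * Γ.spending p M i + b * Γ.spending p M i := add_le_add h1 h2
      _ = Γ.spending p M i := by rw [← add_mul, hab, one_mul]
  · exact (hq i (Γ.u i z) ⟨(hx i).1, (hx i).2.2 z hz hzw⟩ ⟨(hy i).1, (hy i).2.2 z hz hzw⟩
      ha hb hab).2

theorem quasiDemand_subset {p : O → ℝ} {M M' : ℝ} (h : Γ.IsBalanced p M)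
    (h' : Γ.IsBalanced p M') (hle : M ≤ M') : Γ.quasiDemand p M' ⊆ Γ.quasiDemand p M := by
  intro x hx i
  refine ⟨(hx i).1, ?_, fun y hy hyw => (hx i).2.2 y hy (hyw.trans_le (Γ.income_mono p hle i))⟩
  rw [h.spending_eq Γ h']
  exact (hx i).2.1

/-- The excess demands of quasi-demands at balanced incomes. -/
def excessDemand (p : O → ℝ) : Set (O → ℝ) :=
  {z | ∃ M x, Γ.IsBalanced p M ∧ x ∈ Γ.quasiDemand p M ∧ z = ∑ i, x i - Γ.q}

/-- Since spending is the same at all balanced basic incomes, a larger one only makes the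
quasi-demand smaller. Two quasi-demands therefore both belong to the smaller basic income. -/
theorem convex_excessDemand (hq : ∀ i, QuasiconcaveOn ℝ (Γ.C i) (Γ.u i)) (p : O → ℝ) :
    Convex ℝ (Γ.excessDemand p) := by
  rintro _ ⟨M, x, hM, hx, rfl⟩ _ ⟨M', x', hM', hx', rfl⟩ a b ha hb hab
  have key : ∀ N, Γ.IsBalanced p N → x ∈ Γ.quasiDemand p N → x' ∈ Γ.quasiDemand p N →
      a • (∑ i, x i - Γ.q) + b • (∑ i, x' i - Γ.q) ∈ Γ.excessDemand p := by
    intro N hN h h'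
    refine ⟨N, a • x + b • x', hN, Γ.convex_quasiDemand hq p N h h' ha hb hab, ?_⟩
    have h1 : Γ.q = a • Γ.q + b • Γ.q := by rw [← add_smul, hab, one_smul]
    simp only [Pi.add_apply, Pi.smul_apply, sum_add_distrib, ← smul_sum, smul_sub]
    nth_rewrite 3 [h1]
    abel
  rcases le_total M M' with hle | hle
  · exact key M hM hx (Γ.quasiDemand_subset hM hM' hle hx')
  · exact key M' hM' (Γ.quasiDemand_subset hM' hM hle hx) hx'

/-- The strict inequality in `quasiDemand` pays off here: "`y` is not cheaper than the income, or
not better" is a union of two closed conditions, even at zero income. -/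
theorem isCompact_graph_excessDemand :
    IsCompact {x : (O → ℝ) × (O → ℝ) | x.1 ∈ stdSimplex ℝ O ∧ x.2 ∈ Γ.excessDemand x.1} := by
  let B : Set ((O → ℝ) × ℝ × (I → O → ℝ)) :=
    stdSimplex ℝ O ×ˢ Set.Icc 0 Γ.maxIncome ×ˢ Set.univ.pi Γ.C
  have hB : IsCompact B := (isCompact_stdSimplex ℝ O).prod
    (isCompact_Icc.prod (isCompact_univ_pi Γ.isCompact_C))
  let E : Set ((O → ℝ) × ℝ × (I → O → ℝ)) :=
    {b ∈ B | Γ.IsBalanced b.1 b.2.1 ∧ b.2.2 ∈ Γ.quasiDemand b.1 b.2.1}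
  have hpM : Continuous fun b : (O → ℝ) × ℝ × (I → O → ℝ) => (b.1, b.2.1) := by fun_prop
  have hE : IsClosed E := by
    have : E = B ∩ ((fun b => (b.1, b.2.1)) ⁻¹' {x : (O → ℝ) × ℝ | Γ.IsBalanced x.1 x.2} ∩
        ⋂ i, ({b | b.1 ⬝ᵥ b.2.2 i ≤ Γ.spending b.1 b.2.1 i} ∩
        ⋂ y ∈ Γ.C i, ({b | Γ.income b.1 b.2.1 i ≤ b.1 ⬝ᵥ y} ∪
          {b ∈ B | Γ.u i y ≤ Γ.u i (b.2.2 i)}))) := by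
      ext b
      simp only [E, Set.mem_ofPred_eq, Set.mem_inter_iff, Set.mem_preimage, Set.mem_iInter,
        Set.mem_union]
      constructor
      · rintro ⟨hb, h1, h2⟩
        refine ⟨hb, h1, fun i => ⟨(h2 i).2.1, fun y hy => ?_⟩⟩
        rcases le_or_gt (Γ.income b.1 b.2.1 i) (b.1 ⬝ᵥ y) with h | h
        · exact Or.inl h
        · exact Or.inr ⟨hb, (h2 i).2.2 y hy h⟩
      · rintro ⟨hb, h1, h2⟩
        refine ⟨hb, h1, fun i => ⟨hb.2.2 i (Set.mem_univ i), (h2 i).1, fun y hy hyw => ?_⟩⟩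
        rcases (h2 i).2 y hy with h | h
        · exact absurd hyw h.not_gt
        · exact h.2
    rw [this]
    refine hB.isClosed.inter ((Γ.isClosed_isBalanced.preimage hpM).inter
      (isClosed_iInter fun i =>
        IsClosed.inter ?_ (isClosed_biInter fun y hy => IsClosed.union ?_ ?_)))
    · refine isClosed_le ?_ ((Γ.continuous_spending i).comp hpM)
      exact continuous_dotProduct_uncurry.comp
        (f := fun b : (O → ℝ) × ℝ × (I → O → ℝ) => (b.1, b.2.2 i)) (by fun_prop)
    · refine isClosed_le ((Γ.continuous_income i).comp hpM) ?_
      exact continuous_dotProduct_uncurry.comp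
        (f := fun b : (O → ℝ) × ℝ × (I → O → ℝ) => (b.1, y)) (by fun_prop)
    · refine hB.isClosed.isClosed_le continuousOn_const ?_
      refine (Γ.continuousOn_u i).comp (by fun_prop) fun b hb => hb.2.2 i (Set.mem_univ i)
  have hEc : IsCompact E := hB.of_isClosed_subset hE fun b hb => hb.1
  have himg : {x : (O → ℝ) × (O → ℝ) | x.1 ∈ stdSimplex ℝ O ∧ x.2 ∈ Γ.excessDemand x.1} =
      (fun b : (O → ℝ) × ℝ × (I → O → ℝ) => (b.1, ∑ i, b.2.2 i - Γ.q)) '' E := by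
    ext ⟨p, z⟩
    constructor
    · rintro ⟨hp, M, x, hM, hx, hz⟩
      exact ⟨(p, M, x), ⟨⟨hp, hM.1, fun i _ => (hx i).1⟩, hM, hx⟩, Prod.ext rfl hz.symm⟩
    · rintro ⟨⟨p', M, x⟩, ⟨hb, hM, hx⟩, heq⟩
      obtain ⟨rfl, rfl⟩ := Prod.mk.inj heq
      exact ⟨hb.1, M, x, hM, hx, rfl⟩
  rw [himg]
  exact hEc.image (by fun_prop)

/-- There are prices and balanced incomes with a quasi-demand that does not exceed the supply. -/
theorem exists_quasiEquilibrium [Nonempty O] (hq : ∀ i, QuasiconcaveOn ℝ (Γ.C i) (Γ.u i))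
    (hbal : ∀ p ∈ stdSimplex ℝ O, ∃ M, Γ.IsBalanced p M) :
    ∃ p ∈ stdSimplex ℝ O, ∃ M, Γ.IsBalanced p M ∧ ∃ x ∈ Γ.quasiDemand p M,
      ∀ l, ∑ i, x i l ≤ Γ.q l := by
  obtain ⟨p, hp, z, ⟨M, x, hM, hx, rfl⟩, hvi⟩ := exists_le_inner_of_isCompact_graph Γ.excessDemand
    (fun p hp => by
      obtain ⟨M, hM⟩ := hbal p hp
      obtain ⟨x, hx⟩ := Γ.nonempty_quasiDemand p hM.1.1
      exact ⟨_, M, x, hM, hx, rfl⟩)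
    (fun p _ => Γ.convex_excessDemand hq p) Γ.isCompact_graph_excessDemand
  refine ⟨p, hp, M, hM, x, hx, fun l => ?_⟩
  -- This is the weak form of Walras' law; stationarity bounds every excess demand by this value.
  have h1 : p ⬝ᵥ (∑ i, x i - Γ.q) ≤ 0 := by
    rw [dotProduct_sub, dotProduct_sum]
    have := sum_le_sum fun i (_ : i ∈ univ) => (hx i).2.1
    linarith [hM.2.1]
  have h2 := (hvi l).trans h1
  simp only [Pi.sub_apply, Finset.sum_apply] at h2
  linarith

end QuasiEquilibrium

end AllocationProblem

namespace AllocationProblem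

open Finset Filter Topology Matrix

/-! ### From equilibrium to efficiency and absence of justified envy. -/

section Fairness

variable {I O : Type*} [Fintype I] [Fintype O] (Γ : AllocationProblem I O)

theorem U_of_mem {i : I} {x : O → ℝ} (hx : x ∈ Γ.C i) : Γ.U i x = Γ.u i x := if_pos hx

theorem coe_le_U_iff {i : I} {x : O → ℝ} {a : ℝ} :
    (a : EReal) ≤ Γ.U i x ↔ x ∈ Γ.C i ∧ a ≤ Γ.u i x := by
  by_cases hx : x ∈ Γ.C i
  · simp [U, hx]
  · simp [U, hx]

theorem coe_lt_U_iff {i : I} {x : O → ℝ} {a : ℝ} :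
    (a : EReal) < Γ.U i x ↔ x ∈ Γ.C i ∧ a < Γ.u i x := by
  by_cases hx : x ∈ Γ.C i
  · simp [U, hx]
  · simp [U, hx]

variable {Γ}

theorem IsAllocation.isIR_iff {x : I → O → ℝ} (hx : Γ.IsAllocation x) :
    Γ.IsIR x ↔ ∀ i, Γ.r i ≤ Γ.u i (x i) :=
  forall_congr' fun i => Γ.coe_le_U_iff.trans (and_iff_right (hx.1 i))

theorem IsAllocation.isPO_iff {x : I → O → ℝ} (hx : Γ.IsAllocation x) :
    Γ.IsPO x ↔ ∀ y, Γ.IsAllocation y → (∀ i, Γ.u i (x i) ≤ Γ.u i (y i)) →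
      ∀ i, Γ.u i (y i) ≤ Γ.u i (x i) := by
  simp only [IsPO, not_exists, not_and, not_lt]
  refine forall₂_congr fun y hy => ?_
  simp only [Γ.U_of_mem (hx.1 _), Γ.U_of_mem (hy.1 _), EReal.coe_le_coe_iff]

theorem IsAllocation.envies_iff {x : I → O → ℝ} (hx : Γ.IsAllocation x) {i j : I} :
    Γ.Envies x i j ↔ x j ∈ Γ.C i ∧ Γ.u i (x i) < Γ.u i (x j) := by
  rw [Envies, Γ.U_of_mem (hx.1 i), Γ.coe_lt_U_iff]

theorem EnvyChain.lt {x : I → O → ℝ} {i j k : I} (h : Γ.EnvyChain x i j k) {w : I → ℝ}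
    (hw : ∀ i j, Γ.Envies x i j → w i < w j) : w i < w k := by
  obtain ⟨K, s, -, rfl, -, rfl, hs⟩ := h
  have : StrictMono (w ∘ s) := Fin.strictMono_iff_lt_succ.2 fun t => hw _ _ (hs t)
  exact this (Fin.last_pos)

variable (Γ) in
/-- The incomes `w` justify the allocation `x`: an agent who prefers a part of the bundle of
another agent has a smaller income, and an agent who accepts a part of the bundle of another agent
does not have a larger income. -/
structure IsJustifiedBy (w : I → ℝ) (x : I → O → ℝ) : Prop where
  lt_of_lt : ∀ i j, ∀ y ∈ Γ.C i, y ≤ x j → Γ.u i (x i) < Γ.u i y → w i < w j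
  le_of_le : ∀ i j, ∀ y ∈ Γ.C i, y ≤ x j → Γ.r i ≤ Γ.u i y → w i ≤ w j

theorem IsJustifiedBy.not_justifiedEnvyByExchange {w : I → ℝ} {x : I → O → ℝ}
    (h : Γ.IsJustifiedBy w x) (hx : Γ.IsAllocation x) (i j : I) :
    ¬ Γ.JustifiedEnvyByExchange x i j := by
  rintro ⟨k, hchain, hk⟩
  obtain ⟨hC, hu⟩ := Γ.coe_le_U_iff.1 hk
  refine (hchain.lt fun a b hab => ?_).not_ge (h.le_of_le k i _ hC le_rfl hu)
  obtain ⟨hC', hu'⟩ := hx.envies_iff.1 hab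
  exact h.lt_of_lt a b _ hC' le_rfl hu'

variable (Γ)

theorem sum_dotProduct_of_isAllocation {x : I → O → ℝ} (hx : Γ.IsAllocation x) (p : O → ℝ) :
    ∑ i, p ⬝ᵥ x i = p ⬝ᵥ Γ.q := by
  rw [← dotProduct_sum]
  congr 1
  ext l
  rw [Finset.sum_apply, hx.2 l]

/-- An agent who spent less could not be satiated, and by local nonsatiation would find a better
bundle below her income. -/
theorem dotProduct_eq_spending (hq : ∀ i, QuasiconcaveOn ℝ (Γ.C i) (Γ.u i)) {p : O → ℝ} {M : ℝ}
    {x : I → O → ℝ} (hx : x ∈ Γ.quasiDemand p M) (i : I) : p ⬝ᵥ x i = Γ.spending p M i := by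
  refine (hx i).2.1.eq_of_not_lt fun hlt => ?_
  by_cases hb : x i ∈ Γ.bliss i
  · exact (hlt.trans_le (min_le_right _ _)).not_ge (Γ.blissCost_le p hb)
  · have : ∃ b ∈ Γ.C i, Γ.u i (x i) < Γ.u i b := by
      by_contra hcon
      push Not at hcon
      exact hb ⟨(hx i).1, hcon⟩
    obtain ⟨b, hbC, hbu⟩ := this
    obtain ⟨y, hy, hyw, hyu⟩ :=
      Γ.exists_better (hq i) (hx i).1 hbC hbu (hlt.trans_le (min_le_left _ _))
    exact hyu.not_ge ((hx i).2.2 y hy hyw)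

/-- If the income is positive, then a bundle that is optimal among all cheaper bundles is optimal
in the budget set. -/
theorem le_of_dotProduct_le_income {p : O → ℝ} {w : ℝ} (hw : 0 < w) {i : I} {x : O → ℝ}
    (hx : ∀ y ∈ Γ.C i, p ⬝ᵥ y < w → Γ.u i y ≤ Γ.u i x) {y : O → ℝ} (hy : y ∈ Γ.C i)
    (hyw : p ⬝ᵥ y ≤ w) : Γ.u i y ≤ Γ.u i x := by
  refine le_of_tendsto (Γ.tendsto_u_smul hy) ?_
  filter_upwards [Ioo_mem_nhdsLT (zero_lt_one' ℝ)] with t ht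
  refine hx _ (Γ.smul_mem_C hy ht.1.le ht.2.le) ?_
  rw [dotProduct_smul, smul_eq_mul]
  calc t * p ⬝ᵥ y ≤ t * w := mul_le_mul_of_nonneg_left hyw ht.1.le
    _ < w := by nlinarith [ht.2]

/-- At prices `p` and basic income `M`, every agent gets an optimal bundle in her budget set and
spends the required amount, and the total spending is the value of the supply. -/
structure IsIncomeEquilibrium (p : O → ℝ) (M : ℝ) (x : I → O → ℝ) : Prop where
  isAllocation : Γ.IsAllocation x
  dotProduct_eq : ∀ i, p ⬝ᵥ x i = Γ.spending p M i
  optimal : ∀ i, ∀ y ∈ Γ.C i, p ⬝ᵥ y ≤ Γ.income p M i → Γ.u i y ≤ Γ.u i (x i)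

variable {Γ}

theorem IsIncomeEquilibrium.isIR {p : O → ℝ} {M : ℝ} {x : I → O → ℝ}
    (h : Γ.IsIncomeEquilibrium p M x) (hne : ∀ i, (Γ.acceptable i).Nonempty) : Γ.IsIR x := by
  rw [h.isAllocation.isIR_iff]
  intro i
  obtain ⟨z, hz, hzp⟩ := Γ.exists_acceptable_cost (hne i) p
  exact hz.2.trans (h.optimal i z hz.1 (hzp.le.trans (le_max_right _ _)))

/-- First welfare theorem: weakly better bundles cost at least the spending, by nonsatiation or by
minimality of `blissCost`, and strictly better ones cost more than the income. -/
theorem IsIncomeEquilibrium.isPO {p : O → ℝ} {M : ℝ} {x : I → O → ℝ}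
    (h : Γ.IsIncomeEquilibrium p M x) (hq : ∀ i, QuasiconcaveOn ℝ (Γ.C i) (Γ.u i)) :
    Γ.IsPO x := by
  rw [h.isAllocation.isPO_iff]
  intro y hy hxy i
  by_contra hlt
  rw [not_le] at hlt
  have hle : ∀ j, p ⬝ᵥ x j ≤ p ⬝ᵥ y j := by
    intro j
    by_contra hcheap
    rw [not_le, h.dotProduct_eq] at hcheap
    by_cases hb : y j ∈ Γ.bliss j
    · exact (hcheap.trans_le (min_le_right _ _)).not_ge (Γ.blissCost_le p hb)
    · have : ∃ b ∈ Γ.C j, Γ.u j (y j) < Γ.u j b := by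
        by_contra hcon
        push Not at hcon
        exact hb ⟨hy.1 j, hcon⟩
      obtain ⟨b, hbC, hbu⟩ := this
      obtain ⟨z, hz, hzw, hzu⟩ :=
        Γ.exists_better (hq j) (hy.1 j) hbC hbu (hcheap.trans_le (min_le_left _ _))
      exact ((hxy j).trans_lt hzu).not_ge (h.optimal j z hz hzw.le)
  have hlt' : p ⬝ᵥ x i < p ⬝ᵥ y i := by
    rw [h.dotProduct_eq]
    refine (min_le_left _ _).trans_lt ?_
    by_contra hcheap
    exact hlt.not_ge (h.optimal i _ (hy.1 i) (not_lt.1 hcheap))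
  have hsum := sum_lt_sum (fun j _ => hle j) ⟨i, mem_univ i, hlt'⟩
  rw [Γ.sum_dotProduct_of_isAllocation h.isAllocation, Γ.sum_dotProduct_of_isAllocation hy] at hsum
  exact lt_irrefl _ hsum

theorem IsIncomeEquilibrium.isJustifiedBy {p : O → ℝ} (hp : p ∈ stdSimplex ℝ O) {M : ℝ}
    {x : I → O → ℝ} (h : Γ.IsIncomeEquilibrium p M x) : Γ.IsJustifiedBy (Γ.income p M) x := by
  have hspend : ∀ j, ∀ y ≤ x j, p ⬝ᵥ y ≤ Γ.income p M j := fun j y hy =>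
    (sum_le_sum fun l _ => mul_le_mul_of_nonneg_left (hy l) (hp.1 l)).trans
      ((h.dotProduct_eq j).trans_le (min_le_left _ _))
  refine ⟨fun i j y hy hyx hlt => ?_, fun i j y hy hyx hle => ?_⟩
  · by_contra hw
    exact hlt.not_ge (h.optimal i y hy ((hspend j y hyx).trans (not_lt.1 hw)))
  · exact max_le (le_max_left _ _) ((Γ.reservationCost_le p ⟨hy, hle⟩).trans (hspend j y hyx))

theorem isJustifiedBy_of_bliss {x : I → O → ℝ} (hb : ∀ i, x i ∈ Γ.bliss i) :
    Γ.IsJustifiedBy 0 x :=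
  ⟨fun i _ y hy _ hlt => absurd ((hb i).2 y hy) hlt.not_ge, fun _ _ _ _ _ _ => le_rfl⟩

variable (Γ)

/-- If quasi-demands of the whole supply are optimal in the budget sets, then there are continuous
price dependent incomes that support an individually rational and Pareto optimal allocation which
is justified by incomes. -/
theorem exists_fair_equilibrium [Nonempty O] (hq : ∀ i, QuasiconcaveOn ℝ (Γ.C i) (Γ.u i))
    (hIR : ∃ x, Γ.IsAllocation x ∧ Γ.IsIR x)
    (hopt : ∀ p ∈ stdSimplex ℝ O, ∀ M, 0 ≤ M → ∑ i, Γ.spending p M i = p ⬝ᵥ Γ.q →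
      ∀ x ∈ Γ.quasiDemand p M, (∀ l, ∑ i, x i l ≤ Γ.q l) →
      ∀ i, ∀ y ∈ Γ.C i, p ⬝ᵥ y ≤ Γ.income p M i → Γ.u i y ≤ Γ.u i (x i)) :
    ∃ (m : I → stdSimplex ℝ O → NNReal) (x : I → O → ℝ) (p : stdSimplex ℝ O),
      (∀ i, Continuous (m i)) ∧ Γ.IsAllocation x ∧ Γ.IsIR x ∧ Γ.IsPO x ∧
      (∃ w, Γ.IsJustifiedBy w x) ∧
      ∀ i, x i ∈ Γ.budget i (fun l => p.1 l) (m i p) ∧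
        IsMaxOn (Γ.u i) (Γ.budget i (fun l => p.1 l) (m i p)) (x i) := by
  obtain ⟨x₀, hx₀, hx₀IR⟩ := hIR
  rw [hx₀.isIR_iff] at hx₀IR
  have hacc : ∀ i, x₀ i ∈ Γ.acceptable i := fun i => ⟨hx₀.1 i, hx₀IR i⟩
  have hne : ∀ i, (Γ.acceptable i).Nonempty := fun i => ⟨_, hacc i⟩
  have hbal : ∀ p ∈ stdSimplex ℝ O, ∃ M, Γ.IsBalanced p M := fun p hp => by
    refine Γ.exists_isBalanced hne hp ?_
    rw [← Γ.sum_dotProduct_of_isAllocation hx₀]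
    exact sum_le_sum fun i _ => Γ.reservationCost_le p (hacc i)
  choose M₀ hM₀ using fun p : stdSimplex ℝ O => hbal p.1 p.2
  have hσ := Γ.continuous_spending_of_isBalanced hM₀
  -- Every agent is credited with the whole surplus, so that she can afford her part of the
  -- undistributed supply whatever it is. The surplus is zero unless `M = maxIncome`, and then
  -- everybody is satiated.
  let m : I → stdSimplex ℝ O → ℝ := fun i p =>
    Γ.spending p.1 (M₀ p) i + (p.1 ⬝ᵥ Γ.q - ∑ j, Γ.spending p.1 (M₀ p) j)
  have hm0 : ∀ i p, 0 ≤ m i p := fun i p =>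
    add_nonneg (Γ.spending_nonneg p.2 (hM₀ p).1.1 i) (sub_nonneg.2 (hM₀ p).2.1)
  have hm : ∀ i, Continuous (m i) := by
    intro i
    have h1 : ∀ j, Continuous fun p : stdSimplex ℝ O => Γ.spending p.1 (M₀ p) j := fun j =>
      (continuous_apply j).comp hσ
    have h2 : Continuous fun p : stdSimplex ℝ O => p.1 ⬝ᵥ Γ.q :=
      continuous_dotProduct_uncurry.comp (f := fun p : stdSimplex ℝ O => (p.1, Γ.q)) (by fun_prop)
    exact (h1 i).add (h2.sub (continuous_finsetSum _ fun j _ => h1 j))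
  obtain ⟨p, hp, M, hM, z, hz, hzq⟩ := Γ.exists_quasiEquilibrium hq hbal
  obtain ⟨x, hx, hzx, hxle⟩ := Γ.exists_allocation_ge (fun i => (hz i).1) hzq
  have hmp : ∀ i, m i ⟨p, hp⟩ = Γ.spending p M i + (p ⬝ᵥ Γ.q - ∑ j, Γ.spending p M j) := by
    intro i
    simp only [m, (hM₀ ⟨p, hp⟩).spending_eq Γ hM]
  have hcost : ∀ i, p ⬝ᵥ x i ≤ m i ⟨p, hp⟩ := by
    intro i
    have h1 : p ⬝ᵥ x i ≤ p ⬝ᵥ (z i + (Γ.q - ∑ j, z j)) := by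
      refine sum_le_sum fun l _ => mul_le_mul_of_nonneg_left ?_ (hp.1 l)
      simpa [Finset.sum_apply] using hxle i l
    rw [dotProduct_add, dotProduct_sub, dotProduct_sum] at h1
    simp only [Γ.dotProduct_eq_spending hq hz] at h1
    rw [hmp]
    exact h1
  have huzx : ∀ i, Γ.u i (z i) ≤ Γ.u i (x i) := fun i =>
    Γ.u_le_of_le (hz i).1.1 (hx.1 i) (hzx i)
  refine ⟨fun i p => ⟨m i p, hm0 i p⟩, x, ⟨p, hp⟩, fun i => (hm i).subtype_mk _, hx, ?_⟩
  rcases hM.2.2 with heq | hmax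
  · have hopt' : ∀ i, ∀ y ∈ Γ.C i, p ⬝ᵥ y ≤ Γ.income p M i → Γ.u i y ≤ Γ.u i (x i) :=
      fun i y hy hyw => (hopt p hp M hM.1.1 heq z hz hzq i y hy hyw).trans (huzx i)
    have hmp' : ∀ i, m i ⟨p, hp⟩ = Γ.spending p M i := fun i => by
      rw [hmp, heq, sub_self, add_zero]
    have heqm : Γ.IsIncomeEquilibrium p M x := by
      refine ⟨hx, fun i => le_antisymm ((hcost i).trans_eq (hmp' i)) ?_, hopt'⟩
      rw [← Γ.dotProduct_eq_spending hq hz]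
      exact sum_le_sum fun l _ => mul_le_mul_of_nonneg_left (hzx i l) (hp.1 l)
    refine ⟨heqm.isIR hne, heqm.isPO hq, ⟨_, heqm.isJustifiedBy hp⟩, fun i => ?_⟩
    refine ⟨⟨hx.1 i, hcost i⟩, fun y hy => hopt' i y hy.1 (hy.2.trans ?_)⟩
    exact (hmp' i).trans_le (min_le_left _ _)
  · have hbliss : ∀ i, x i ∈ Γ.bliss i := by
      intro i
      obtain ⟨b, hb, hbp⟩ := Γ.exists_bliss_cost i p
      have h1 : Γ.u i b ≤ Γ.u i (z i) := by
        refine (hz i).2.2 b hb.1 (hbp.trans_lt ((Γ.blissCost_lt_maxIncome hp).trans_le ?_))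
        rw [← hmax]
        exact le_max_left _ _
      exact ⟨hx.1 i, fun y hy => (hb.2 y hy).trans (h1.trans (huzx i))⟩
    refine ⟨hx.isIR_iff.2 fun i => (hx₀IR i).trans ((hbliss i).2 _ (hx₀.1 i)),
      hx.isPO_iff.2 fun y hy _ i => (hbliss i).2 _ (hy.1 i),
      ⟨_, isJustifiedBy_of_bliss hbliss⟩, fun i => ?_⟩
    exact ⟨⟨hx.1 i, hcost i⟩, fun y hy => (hbliss i).2 y hy.1⟩

end Fairness

end AllocationProblem

namespace AllocationProblem

open Finset Filter Topology Matrix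

/-! ### Part (A): lowered reservation utilities and limits. -/

section Concave

variable {I O : Type*} [Fintype I] [Fintype O] (Γ : AllocationProblem I O)

theorem dotProduct_pos_of_mem_stdSimplex {p z : O → ℝ} (hp : p ∈ stdSimplex ℝ O)
    (hz : ∀ l, 0 < z l) : 0 < p ⬝ᵥ z := by
  have hnn : ∀ l ∈ univ, 0 ≤ p l * z l := fun l _ => mul_nonneg (hp.1 l) (hz l).le
  refine (sum_nonneg hnn).lt_of_ne fun h => ?_
  have h1 := (sum_eq_zero_iff_of_nonneg hnn).1 h.symm
  have h2 : ∑ l, p l = 0 := sum_eq_zero fun l hl =>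
    (mul_eq_zero.1 (h1 l hl)).resolve_right (hz l).ne'
  rw [hp.2] at h2
  exact one_ne_zero h2

/-- If some allocation is better than the reservation utilities for all agents, then the basic
income in an equilibrium is positive. -/
theorem pos_of_sum_spending_eq {x₀ : I → O → ℝ} (hx₀ : Γ.IsAllocation x₀)
    (hlt : ∀ i, Γ.r i < Γ.u i (x₀ i)) {p : O → ℝ} (hp : p ∈ stdSimplex ℝ O) {M : ℝ}
    (hM : 0 ≤ M) (hsum : ∑ i, Γ.spending p M i = p ⬝ᵥ Γ.q) : 0 < M := by
  refine hM.lt_of_ne ?_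
  rintro rfl
  have hev : ∀ᶠ t in 𝓝[<] (1 : ℝ), ∀ i, Γ.r i < Γ.u i (t • x₀ i) :=
    eventually_all.2 fun i => (Γ.tendsto_u_smul (hx₀.1 i)).eventually (lt_mem_nhds (hlt i))
  obtain ⟨t, ht, ht'⟩ := (hev.and (Ioo_mem_nhdsLT (zero_lt_one' ℝ))).exists
  have h1 : ∀ i, Γ.spending p 0 i ≤ t * p ⬝ᵥ x₀ i := by
    intro i
    have hC := Γ.smul_mem_C (hx₀.1 i) ht'.1.le ht'.2.le
    have h2 := Γ.reservationCost_le p (⟨hC, (ht i).le⟩ : t • x₀ i ∈ Γ.acceptable i)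
    rw [dotProduct_smul, smul_eq_mul] at h2
    exact (min_le_left _ _).trans
      (max_le (mul_nonneg ht'.1.le (Γ.dotProduct_nonneg_of_mem hp (hx₀.1 i))) h2)
  have h2 := sum_le_sum fun i (_ : i ∈ univ) => h1 i
  rw [hsum, ← mul_sum, Γ.sum_dotProduct_of_isAllocation hx₀] at h2
  nlinarith [dotProduct_pos_of_mem_stdSimplex hp Γ.q_pos, ht'.2]

theorem exists_isJustifiedBy_of_lt [Nonempty O] (hq : ∀ i, QuasiconcaveOn ℝ (Γ.C i) (Γ.u i))
    (h : ∃ x, Γ.IsAllocation x ∧ ∀ i, Γ.r i < Γ.u i (x i)) :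
    ∃ x, Γ.IsAllocation x ∧ Γ.IsIR x ∧ Γ.IsPO x ∧ ∃ w, Γ.IsJustifiedBy w x := by
  obtain ⟨x₀, hx₀, hlt⟩ := h
  obtain ⟨-, x, -, -, h1, h2, h3, h4, -⟩ := Γ.exists_fair_equilibrium hq
    ⟨x₀, hx₀, hx₀.isIR_iff.2 fun i => (hlt i).le⟩ fun p hp M hM hsum x hx _ i y hy hyw =>
      Γ.le_of_dotProduct_le_income
        ((Γ.pos_of_sum_spending_eq hx₀ hlt hp hM hsum).trans_le (le_max_left _ _))
        (hx i).2.2 hy hyw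
  exact ⟨x, h1, h2, h3, h4⟩

/-- The allocation problem with other reservation utilities. -/
def withReservation (r : I → ℝ) : AllocationProblem I O := { Γ with r := r }

theorem isClosed_isAllocation : IsClosed {x | Γ.IsAllocation x} := by
  have : {x | Γ.IsAllocation x} =
      Set.univ.pi Γ.C ∩ ⋂ l, {x : I → O → ℝ | ∑ i, x i l = Γ.q l} := by
    ext x
    simp [IsAllocation]
  rw [this]
  exact (isClosed_set_pi fun i _ => (Γ.isCompact_C i).isClosed).inter
    (isClosed_iInter fun l => isClosed_eq (by fun_prop) continuous_const)

theorem isCompact_isAllocation : IsCompact {x | Γ.IsAllocation x} :=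
  (isCompact_univ_pi Γ.isCompact_C).of_isClosed_subset Γ.isClosed_isAllocation
    fun _ hx i _ => hx.1 i

variable {Γ}

theorem tendsto_u_apply {X : ℕ → I → O → ℝ} {x : I → O → ℝ} (hX : ∀ n, Γ.IsAllocation (X n))
    (hx : Γ.IsAllocation x) (hlim : Tendsto X atTop (𝓝 x)) (i : I) :
    Tendsto (fun n => Γ.u i (X n i)) atTop (𝓝 (Γ.u i (x i))) :=
  (Γ.continuousOn_u i (x i) (hx.1 i)).tendsto.comp (tendsto_nhdsWithin_iff.2
    ⟨tendsto_pi_nhds.1 hlim i, Eventually.of_forall fun n => (hX n).1 i⟩)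

/-- The bundle `X n j` may violate the demand bound of `i` although its limit does not. Cutting it
off at `x j` repairs this, which is why `IsJustifiedBy` speaks of parts of bundles. -/
theorem tendsto_u_inf {X : ℕ → I → O → ℝ} {x : I → O → ℝ} (hX : ∀ n, Γ.IsAllocation (X n))
    (hx : Γ.IsAllocation x) (hlim : Tendsto X atTop (𝓝 x)) {i j : I} (hij : x j ∈ Γ.C i) :
    (∀ n, X n j ⊓ x j ∈ Γ.C i) ∧
      Tendsto (fun n => Γ.u i (X n j ⊓ x j)) atTop (𝓝 (Γ.u i (x j))) := by
  have hmem : ∀ n, X n j ⊓ x j ∈ Γ.C i := fun n =>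
    ⟨le_inf ((hX n).1 j).1 (hx.1 j).1,
      (sum_le_sum fun l _ => (inf_le_right : X n j ⊓ x j ≤ x j) l).trans hij.2⟩
  refine ⟨hmem, (Γ.continuousOn_u i (x j) hij).tendsto.comp (tendsto_nhdsWithin_iff.2
    ⟨?_, Eventually.of_forall hmem⟩)⟩
  rw [tendsto_pi_nhds]
  intro l
  have h1 := (tendsto_pi_nhds.1 (tendsto_pi_nhds.1 hlim j) l).min
    (tendsto_const_nhds (x := x j l))
  rw [min_self] at h1
  exact h1

theorem isWeaklyPO_of_tendsto [Nonempty O] {X : ℕ → I → O → ℝ} {x : I → O → ℝ}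
    (hX : ∀ n, Γ.IsAllocation (X n)) (hx : Γ.IsAllocation x) (hlim : Tendsto X atTop (𝓝 x))
    (hPO : ∀ n, Γ.IsPO (X n)) : Γ.IsWeaklyPO x := by
  rintro ⟨y, hy, hlt⟩
  simp only [Γ.U_of_mem (hx.1 _), Γ.U_of_mem (hy.1 _), EReal.coe_lt_coe_iff] at hlt
  have hev : ∀ᶠ n in atTop, ∀ i, Γ.u i (X n i) < Γ.u i (y i) :=
    eventually_all.2 fun i => (tendsto_u_apply hX hx hlim i).eventually (gt_mem_nhds (hlt i))
  obtain ⟨n, hn⟩ := hev.exists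
  -- Without agents every allocation would be vacuously dominated in the weak sense; a positive
  -- supply excludes this.
  have hI : Nonempty I := by
    by_contra hcon
    rw [not_nonempty_iff] at hcon
    obtain ⟨l⟩ := ‹Nonempty O›
    have := hx.2 l
    rw [univ_eq_empty, sum_empty] at this
    exact (Γ.q_pos l).ne this
  obtain ⟨i⟩ := hI
  exact (hn i).not_ge ((hX n).isPO_iff.1 (hPO n) y hy (fun i => (hn i).le) i)

/-- In the linear case, limits of Pareto optimal allocations are Pareto optimal. -/
theorem IsLinear.isPO_of_tendsto (hlin : Γ.IsLinear) {X : ℕ → I → O → ℝ} {x : I → O → ℝ}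
    (hX : ∀ n, Γ.IsAllocation (X n)) (hx : Γ.IsAllocation x) (hlim : Tendsto X atTop (𝓝 x))
    (hPO : ∀ n, Γ.IsPO (X n)) : Γ.IsPO x := by
  rw [hx.isPO_iff]
  intro y hy hxy i
  by_contra hlt
  rw [not_le] at hlt
  have hlim' : ∀ i l, Tendsto (fun n => X n i l) atTop (𝓝 (x i l)) := fun i l =>
    tendsto_pi_nhds.1 (tendsto_pi_nhds.1 hlim i) l
  -- Half of the improving direction is eventually feasible at `X n`: constraints binding at `x` are
  -- not tightened by it, and the others keep some slack. By linearity each agent gains exactly half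
  -- of her gain from `x` to `y`.
  let Y : ℕ → I → O → ℝ := fun n i l => X n i l + (y i l - x i l) / 2
  have hnonneg : ∀ i l, ∀ᶠ n in atTop, 0 ≤ Y n i l := by
    intro i l
    have hy0 : 0 ≤ y i l := (hy.1 i).1 l
    have hx0 : 0 ≤ x i l := (hx.1 i).1 l
    rcases hx0.eq_or_lt with h0 | hpos
    · refine Eventually.of_forall fun n => ?_
      have h1 : 0 ≤ X n i l := ((hX n).1 i).1 l
      simp only [Y, ← h0]
      linarith
    · have h1 : x i l / 2 < x i l := by linarith
      filter_upwards [(hlim' i l).eventually (lt_mem_nhds h1)] with n hn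
      simp only [Y]
      linarith
  have hcap : ∀ i, ∀ᶠ n in atTop, ∑ l, Y n i l ≤ Γ.c i := by
    intro i
    have hY : ∀ n, ∑ l, Y n i l = ∑ l, X n i l + (∑ l, y i l - ∑ l, x i l) / 2 := fun n => by
      simp only [Y, sum_add_distrib, ← sum_div, sum_sub_distrib]
    have hyc := (hy.1 i).2
    rcases (hx.1 i).2.eq_or_lt with h0 | hlt
    · refine Eventually.of_forall fun n => ?_
      have h1 := ((hX n).1 i).2
      rw [hY]
      linarith
    · have h1 : ∑ l, x i l < Γ.c i - (∑ l, y i l - ∑ l, x i l) / 2 := by linarith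
      have h2 : Tendsto (fun n => ∑ l, X n i l) atTop (𝓝 (∑ l, x i l)) :=
        tendsto_finsetSum _ fun l _ => hlim' i l
      filter_upwards [h2.eventually (gt_mem_nhds h1)] with n hn
      rw [hY]
      linarith
  obtain ⟨n, hn1, hn2⟩ := ((eventually_all.2 fun i => eventually_all.2 (hnonneg i)).and
    (eventually_all.2 hcap)).exists
  have hYC : ∀ i, Y n i ∈ Γ.C i := fun i => ⟨hn1 i, hn2 i⟩
  have hYall : Γ.IsAllocation (Y n) := by
    refine ⟨hYC, fun l => ?_⟩
    simp only [Y, sum_add_distrib, ← sum_div, sum_sub_distrib]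
    rw [(hX n).2 l, hx.2 l, hy.2 l, sub_self, zero_div, add_zero]
  have hYu : ∀ i, Γ.u i (Y n i) = Γ.u i (X n i) + (Γ.u i (y i) - Γ.u i (x i)) / 2 := by
    intro i
    obtain ⟨v, hv⟩ := hlin i
    rw [hv _ (hYC i), hv _ ((hX n).1 i), hv _ (hy.1 i), hv _ (hx.1 i), ← sum_sub_distrib, sum_div,
      ← sum_add_distrib]
    refine sum_congr rfl fun l _ => ?_
    simp only [Y]
    ring
  have h1 := (hX n).isPO_iff.1 (hPO n) (Y n) hYall (fun j => by
    rw [hYu]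
    linarith [hxy j]) i
  rw [hYu] at h1
  linarith

/-- A limit of allocations that are justified by incomes, for reservation utilities that are not
larger, has no strong justified envy by exchange. -/
theorem not_strongJustifiedEnvyByExchange_of_tendsto {X : ℕ → I → O → ℝ} {x : I → O → ℝ}
    (hX : ∀ n, Γ.IsAllocation (X n)) (hx : Γ.IsAllocation x) (hlim : Tendsto X atTop (𝓝 x))
    {w r : ℕ → I → ℝ} (hr : ∀ n, r n ≤ Γ.r)
    (hw : ∀ n, (Γ.withReservation (r n)).IsJustifiedBy (w n) (X n)) (i j : I) :
    ¬ Γ.StrongJustifiedEnvyByExchange x i j := by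
  rintro ⟨k, hchain, hk⟩
  obtain ⟨hkC, hku⟩ := Γ.coe_lt_U_iff.1 hk
  have henvy : ∀ᶠ n in atTop, ∀ a b, Γ.Envies x a b → w n a < w n b := by
    refine eventually_all.2 fun a => eventually_all.2 fun b => ?_
    by_cases hab : Γ.Envies x a b
    · obtain ⟨hC, hu⟩ := hx.envies_iff.1 hab
      obtain ⟨hmem, hlimu⟩ := tendsto_u_inf hX hx hlim hC
      filter_upwards [(tendsto_u_apply hX hx hlim a).eventually_lt hlimu hu] with n hn _
      exact (hw n).lt_of_lt a b _ (hmem n) inf_le_left hn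
    · exact Eventually.of_forall fun n h => absurd h hab
  obtain ⟨hmem, hlimu⟩ := tendsto_u_inf hX hx hlim hkC
  obtain ⟨n, hn1, hn2⟩ := (henvy.and (hlimu.eventually (lt_mem_nhds hku))).exists
  exact (hchain.lt hn1).not_ge
    ((hw n).le_of_le k i _ (hmem n) inf_le_left ((hr n k).trans hn2.le))

variable (Γ)

theorem exists_isWeaklyPO_not_strongJustifiedEnvyByExchange [Nonempty O]
    (hq : ∀ i, QuasiconcaveOn ℝ (Γ.C i) (Γ.u i)) (hIR : ∃ x, Γ.IsAllocation x ∧ Γ.IsIR x) :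
    ∃ x, Γ.IsAllocation x ∧ Γ.IsIR x ∧ Γ.IsWeaklyPO x ∧ (Γ.IsLinear → Γ.IsPO x) ∧
      ∀ i j, ¬ Γ.StrongJustifiedEnvyByExchange x i j := by
  obtain ⟨x₀, hx₀, hx₀IR⟩ := hIR
  rw [hx₀.isIR_iff] at hx₀IR
  let r : ℕ → I → ℝ := fun n i => Γ.r i - 1 / ((n : ℝ) + 1)
  have hr : ∀ n i, r n i < Γ.r i := fun n i => sub_lt_self _ Nat.one_div_pos_of_nat
  choose X hX hXIR hXPO w hw using fun n => (Γ.withReservation (r n)).exists_isJustifiedBy_of_lt hq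
    ⟨x₀, hx₀, fun i => (hr n i).trans_le (hx₀IR i)⟩
  obtain ⟨x, hx, φ, hφ, hlim⟩ := Γ.isCompact_isAllocation.tendsto_subseq hX
  have hXφ : ∀ n, Γ.IsAllocation ((X ∘ φ) n) := fun n => hX (φ n)
  refine ⟨x, hx, ?_, isWeaklyPO_of_tendsto hXφ hx hlim fun n => hXPO (φ n),
    fun hlin => hlin.isPO_of_tendsto hXφ hx hlim fun n => hXPO (φ n),
    not_strongJustifiedEnvyByExchange_of_tendsto hXφ hx hlim (fun n i => (hr (φ n) i).le)
      fun n => hw (φ n)⟩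
  rw [hx.isIR_iff]
  intro i
  have h1 : Tendsto (fun n => r (φ n) i) atTop (𝓝 (Γ.r i)) := by
    have := (tendsto_const_nhds (x := Γ.r i)).sub
      (tendsto_one_div_add_atTop_nhds_zero_nat.comp hφ.tendsto_atTop)
    rw [sub_zero] at this
    exact this
  exact le_of_tendsto_of_tendsto' h1 (tendsto_u_apply hXφ hx hlim i) fun n =>
    (IsAllocation.isIR_iff (Γ := Γ.withReservation (r (φ n))) (hX (φ n))).1 (hXIR (φ n)) i

/-- With reservation utilities lowered by `ε`, strong justified envy is `ε`-justified envy, and weak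
Pareto optimality implies the approximate one. -/
theorem exists_isApproxPO_not_approxJustifiedEnvyByExchange [Nonempty O]
    (hq : ∀ i, QuasiconcaveOn ℝ (Γ.C i) (Γ.u i)) (hIR : ∃ x, Γ.IsAllocation x ∧ Γ.IsIR x)
    {ε : ℝ} (hε : 0 < ε) :
    ∃ x, Γ.IsAllocation x ∧ Γ.IsApproxIR ε x ∧ Γ.IsApproxPO ε x ∧
      ∀ i j, ¬ Γ.ApproxJustifiedEnvyByExchange ε x i j := by
  obtain ⟨x₀, hx₀, hx₀IR⟩ := hIR
  obtain ⟨x, hx, hxIR, hxPO, -, hxJE⟩ := (Γ.withReservation fun i => Γ.r i - ε)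
    |>.exists_isWeaklyPO_not_strongJustifiedEnvyByExchange hq ⟨x₀, hx₀, fun i =>
      (EReal.coe_le_coe_iff.2 (sub_le_self _ hε.le)).trans (hx₀IR i)⟩
  refine ⟨x, hx, hxIR, ?_, hxJE⟩
  rintro ⟨y, hy, hlt⟩
  refine hxPO ⟨y, hy, fun i => lt_of_le_of_lt ?_ (hlt i)⟩
  exact le_add_of_nonneg_right (EReal.coe_nonneg.2 hε.le)

end Concave

/-! ### Part (B): quasi-demand is demand. -/

section Quasiconcave

variable {I O : Type*} [Fintype I] [Fintype O] (Γ : AllocationProblem I O)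

/-- A free object would be demanded further by any agent with positive spending, as no agent's
demand bound can bind. So prices are positive, and zero income affords only the zero bundle. -/
theorem StronglyMonotone.quasiDemand_optimal (hmono : Γ.StronglyMonotone)
    (hc : ∀ i, ∑ l, Γ.q l < Γ.c i) {p : O → ℝ} (hp : p ∈ stdSimplex ℝ O) {M : ℝ} (hM : 0 ≤ M)
    (hsum : ∑ i, Γ.spending p M i = p ⬝ᵥ Γ.q) {x : I → O → ℝ} (hx : x ∈ Γ.quasiDemand p M)
    (hxq : ∀ l, ∑ i, x i l ≤ Γ.q l) (i : I) {y : O → ℝ} (hy : y ∈ Γ.C i)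
    (hyw : p ⬝ᵥ y ≤ Γ.income p M i) : Γ.u i y ≤ Γ.u i (x i) := by
  classical
  have hppos : ∀ l, 0 < p l := by
    by_contra hcon
    push Not at hcon
    obtain ⟨l, hl⟩ := hcon
    have hl0 : p l = 0 := le_antisymm hl (hp.1 l)
    obtain ⟨j, -, hj⟩ : ∃ j ∈ univ, 0 < Γ.spending p M j :=
      exists_lt_of_sum_lt (by
        rw [hsum, sum_const_zero]
        exact dotProduct_pos_of_mem_stdSimplex hp Γ.q_pos)
    have hxc : ∑ l, x j l < Γ.c j := by
      refine lt_of_le_of_lt (sum_le_sum fun l _ => ?_) (hc j)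
      exact (single_le_sum (f := fun i => x i l) (fun i _ => (hx i).1.1 l) (mem_univ j)).trans
        (hxq l)
    set δ := Γ.c j - ∑ l, x j l
    have hδ : 0 < δ := sub_pos.2 hxc
    let z : O → ℝ := x j + Pi.single l δ
    have hxz : x j < z := lt_add_of_pos_right _ (Pi.single_pos.2 hδ)
    have hzC : z ∈ Γ.C j := by
      refine ⟨(hx j).1.1.trans hxz.le, ?_⟩
      simp only [z, Pi.add_apply, sum_add_distrib, sum_pi_single', mem_univ, if_true, δ]
      linarith
    have hpz : p ⬝ᵥ z = p ⬝ᵥ x j := by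
      rw [dotProduct_add, dotProduct_single, hl0, zero_mul, add_zero]
    refine (hmono j (hx j).1 hzC hxz).not_ge (Γ.le_of_dotProduct_le_income
      (hj.trans_le (min_le_left _ _)) (hx j).2.2 hzC ?_)
    rw [hpz]
    exact (hx j).2.1.trans (min_le_left _ _)
  rcases (hM.trans (le_max_left _ _) : 0 ≤ Γ.income p M i).eq_or_lt with h0 | hpos
  · have hzero : ∀ z ∈ Γ.C i, p ⬝ᵥ z ≤ Γ.income p M i → z = 0 := by
      intro z hz hzw
      have hnn : ∀ l ∈ univ, 0 ≤ p l * z l := fun l _ => mul_nonneg (hp.1 l) (hz.1 l)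
      have h1 : ∑ l, p l * z l = 0 := le_antisymm (h0 ▸ hzw) (sum_nonneg hnn)
      ext l
      exact (mul_eq_zero.1 ((sum_eq_zero_iff_of_nonneg hnn).1 h1 l (mem_univ l))).resolve_left
        (hppos l).ne'
    rw [hzero y hy hyw, hzero (x i) (hx i).1 ((hx i).2.1.trans (min_le_left _ _))]
  · exact Γ.le_of_dotProduct_le_income hpos (hx i).2.2 hy hyw

-- Acceptable bundles have no zero coordinate, hence positive cost at all prices.
variable {Γ} in
theorem Inada.reservationCost_pos {i : I} (h : Γ.Inada i) (h0 : Γ.u i 0 < Γ.r i)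
    (hne : (Γ.acceptable i).Nonempty) {p : O → ℝ} (hp : p ∈ stdSimplex ℝ O) :
    0 < Γ.reservationCost i p := by
  obtain ⟨z, hz, hzp⟩ := Γ.exists_acceptable_cost hne p
  have hzpos : ∀ l, 0 < z l := by
    by_contra hcon
    exact (h0.trans_le hz.2).ne' (h z hz.1 hcon)
  rw [← hzp]
  exact dotProduct_pos_of_mem_stdSimplex hp hzpos

/-- If there is an individually rational allocation of positive bundles, then all incomes in an
equilibrium are positive. -/
theorem income_pos_of_sum_spending_eq {x₀ : I → O → ℝ} (hx₀ : Γ.IsAllocation x₀)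
    (hIR : Γ.IsIR x₀) (hpos : ∀ i l, 0 < x₀ i l) {p : O → ℝ} (hp : p ∈ stdSimplex ℝ O) {M : ℝ}
    (hM : 0 ≤ M) (hsum : ∑ i, Γ.spending p M i = p ⬝ᵥ Γ.q) (i : I) : 0 < Γ.income p M i := by
  by_contra hle
  rw [not_lt] at hle
  obtain rfl : M = 0 := le_antisymm ((le_max_left _ _).trans hle) hM
  rw [hx₀.isIR_iff] at hIR
  have h1 : ∀ j, Γ.spending p 0 j ≤ p ⬝ᵥ x₀ j := fun j => (min_le_left _ _).trans
    (max_le (Γ.dotProduct_nonneg_of_mem hp (hx₀.1 j)) (Γ.reservationCost_le p ⟨hx₀.1 j, hIR j⟩))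
  have h2 : 0 < p ⬝ᵥ x₀ i := dotProduct_pos_of_mem_stdSimplex hp (hpos i)
  have h3 := sum_lt_sum (fun j _ => h1 j)
    ⟨i, mem_univ i, ((min_le_left _ _).trans hle).trans_lt h2⟩
  rw [hsum, Γ.sum_dotProduct_of_isAllocation hx₀] at h3
  exact lt_irrefl _ h3

end Quasiconcave

end AllocationProblem

theorem theorem4 {I O : Type*} [Fintype I] [Fintype O] [Nonempty O]
    (Γ : AllocationProblem I O)
    (hIR : ∃ x, Γ.IsAllocation x ∧ Γ.IsIR x) :
    ((∀ i, ConcaveOn ℝ (Γ.C i) (Γ.u i)) →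
      (∀ ε : ℝ, 0 < ε → ∃ x, Γ.IsAllocation x ∧ Γ.IsApproxIR ε x ∧ Γ.IsApproxPO ε x ∧
        ∀ i j, ¬ Γ.ApproxJustifiedEnvyByExchange ε x i j) ∧
      (∃ x, Γ.IsAllocation x ∧ Γ.IsIR x ∧ Γ.IsWeaklyPO x ∧
        ∀ i j, ¬ Γ.StrongJustifiedEnvyByExchange x i j) ∧
      (Γ.IsLinear → ∃ x, Γ.IsAllocation x ∧ Γ.IsIR x ∧ Γ.IsPO x ∧
        ∀ i j, ¬ Γ.StrongJustifiedEnvyByExchange x i j)) ∧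
    ((∀ i, QuasiconcaveOn ℝ (Γ.C i) (Γ.u i)) →
      ((Γ.StronglyMonotone ∧ ∀ i, ∑ l, Γ.q l < Γ.c i) ∨
        (∀ i, Γ.Inada i ∧ Γ.u i 0 < Γ.r i) ∨
        ((∃ l, ∀ i, Γ.IsFavorite i l) ∧
          ∃ x, Γ.IsAllocation x ∧ Γ.IsIR x ∧ ∀ i l, 0 < x i l)) →
      ∃ (m : I → stdSimplex ℝ O → NNReal) (x : I → O → ℝ) (p : stdSimplex ℝ O),
        (∀ i, Continuous (m i)) ∧
        Γ.IsAllocation x ∧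
        Γ.IsIR x ∧ Γ.IsPO x ∧ (∀ i j, ¬ Γ.JustifiedEnvyByExchange x i j) ∧
        ∀ i, x i ∈ Γ.budget i (fun l => p.1 l) (m i p) ∧
          IsMaxOn (Γ.u i) (Γ.budget i (fun l => p.1 l) (m i p)) (x i)) := by
  constructor
  · intro hconc
    have hq := fun i => (hconc i).quasiconcaveOn
    obtain ⟨x, hx, hxIR, hxWPO, hxPO, hxJE⟩ :=
      Γ.exists_isWeaklyPO_not_strongJustifiedEnvyByExchange hq hIR
    exact ⟨fun ε hε => Γ.exists_isApproxPO_not_approxJustifiedEnvyByExchange hq hIR hε,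
      ⟨x, hx, hxIR, hxWPO, hxJE⟩, fun hlin => ⟨x, hx, hxIR, hxPO hlin, hxJE⟩⟩
  · intro hq hcases
    obtain ⟨m, x, p, hm, hx, hxIR, hxPO, ⟨w, hw⟩, hopt⟩ := Γ.exists_fair_equilibrium hq hIR (by
      intro p hp M hM hsum x hx hxq i y hy hyw
      rcases hcases with ⟨hmono, hc⟩ | hInada | ⟨-, x₀, hx₀, hx₀IR, hpos⟩
      · exact hmono.quasiDemand_optimal Γ hc hp hM hsum hx hxq i hy hyw
      · obtain ⟨x₀, hx₀, hx₀IR⟩ := hIR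
        have hacc : x₀ i ∈ Γ.acceptable i := ⟨hx₀.1 i, hx₀.isIR_iff.1 hx₀IR i⟩
        exact Γ.le_of_dotProduct_le_income (((hInada i).1.reservationCost_pos (hInada i).2
          ⟨_, hacc⟩ hp).trans_le (le_max_right _ _)) (hx i).2.2 hy hyw
      · exact Γ.le_of_dotProduct_le_income
          (Γ.income_pos_of_sum_spending_eq hx₀ hx₀IR hpos hp hM hsum i) (hx i).2.2 hy hyw)
    exact ⟨m, x, p, hm, hx, hxIR, hxPO, hw.not_justifiedEnvyByExchange hx, hopt⟩
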